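/- Let $\mathcal X$ be a finite set, $\mathcal H$ a finite-dimensional complex Hilbert space, and let $W:\mathcal X\to\mathcal S(\mathcal H)$, $x\mapsto W_x$, be a classical–quantum channel, i.e. every $W_x$ is a density operator (positive semidefinite, trace one) on $\mathcal H$. Its memoryless $n$-block extension is $W^n_{x^n}=W_{x_1}\otimes\cdots\otimes W_{x_n}$ on $\mathcal H^{\otimes n}$, and for a probability distribution $P$ on $\mathcal X^n$ put $PW^n=\sum_{x^n}P(x^n)W^n_{x^n}$. Fix a base $b>1$ (for instance $b=2$ or $b=e$), write $\exp(t)=b^t$ and $\log=\log_b$. The Holevo capacity is $$C(W)=\max_{P}\Big[H\Big(\sum_{x}P(x)W_x\Big)-\sum_{x}P(x)H(W_x)\Big],\qquad H(\rho)=-\operatorname{Tr}\rho\log\rho,$$ the maximum being over all probability distributions $P$ on $\mathcal X$. An $(n,N,\lambda_1,\lambda_2)$ quantum identification code is a family $(P_i,D_i)_{i=1}^N$ of probability distributions $P_i$ on $\mathcal X^n$ and operators $0\le D_i\le\mathbb 1$ on $\mathcal H^{\otimes n}$ (not required to be simultaneously measurable) such that $$\operatorname{Tr}\big(P_iW^n(\mathbb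 1-D_i)\big)\le\lambda_1,\qquad \operatorname{Tr}\big(P_jW^n D_i\big)\le\lambda_2\qquad\text{for all } i\ne j;$$ $N(n,\lambda_1,\lambda_2)$ is the maximal $N$ for which such a code exists. **Theorem (strong converse for quantum identification).** Let $\lambda_1,\lambda_2>0$ with $\lambda_1+\lambda_2<1$. For every $\delta>0$ and all sufficiently large $n$, the maximum $N(n,\lambda_1,\lambda_2)$ is finite and $$N(n,\lambda_1,\lambda_2)\le\exp\big(\exp(n(C(W)+\delta))\big).$$ In particular the classical strong converse holds: if $V(y|x)$ is a classical channel with finite input and output alphabets $\mathcal X,\mathcal Y$, $C(V)$ is its Shannon capacity (to the base $b$), and $N(n,\lambda_1,\lambda_2)$ is the maximal $N$ for which there are probability distributions $P_i$ on $\mathcal X^n$ and sets $\mathcal D_i\subset\mathcal Y^n$, $i=1,\dots,N$, with $P_iV^n(\mathcal D_i^c)\le\lambda_1$ and $P_jV^n(\mathcal D_i)\le\lambda_2$ for all $i\ne j$, then for every $\delta>0$ and all sufficiently large $n$ again $N(n,\lambda_1,\lambda_2)\le\exp(\exp(n(C(V)+\delta)))$. -/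

import Mathlib

open scoped BigOperators Matrix ComplexOrder

noncomputable section

namespace QID

/-! ### Classical–quantum channels

A finite-dimensional complex Hilbert space with a fixed orthonormal basis indexed by `ι` is `ℂ^ι`;
its operators are the matrices over `ι`, and the operators of its `n`-fold tensor power are the
matrices over `Fin n → ι`. Probability distributions on a finite set `X` are the elements of
`stdSimplex ℝ X`. All entropies are taken to the logarithmic base `b`. -/

/-- A classical–quantum channel: a map from a finite alphabet to density operators. -/
structure CQChannel (X ι : Type*) [Fintype X] [Fintype ι] where
  /-- The output state `W_x` for the input letter `x`. -/
  state : X → Matrix ι ι ℂ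
  posSemidef : ∀ x, (state x).PosSemidef
  trace_eq_one : ∀ x, (state x).trace = 1

/-- The von Neumann entropy `-Tr (ρ log ρ)` to the base `b`. The logarithm of `ρ` is given by the
functional calculus; `Real.logb b 0 = 0` implements the convention `0 log 0 = 0`. -/
def vonNeumannEntropy {ι : Type*} [Fintype ι] [DecidableEq ι] (b : ℝ) (ρ : Matrix ι ι ℂ) : ℝ :=
  -(ρ * cfc (Real.logb b) ρ).trace.re

/-- The tensor product `A 0 ⊗ ⋯ ⊗ A (n - 1)` of operators on `ℂ^ι`, as an operator on the `n`-fold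
tensor power (an iterated Kronecker product). -/
def tensorProd {ι : Type*} {n : ℕ} (A : Fin n → Matrix ι ι ℂ) :
    Matrix (Fin n → ι) (Fin n → ι) ℂ :=
  Matrix.of fun i j => ∏ k, A k (i k) (j k)

namespace CQChannel

variable {X ι : Type*} [Fintype X] [Fintype ι]

/-- The output state `PW = ∑ x, P(x) W_x`. -/
def output (W : CQChannel X ι) (P : X → ℝ) : Matrix ι ι ℂ :=
  ∑ x, (P x : ℂ) • W.state x

/-- The `n`-block output state `W_{x_1} ⊗ ⋯ ⊗ W_{x_n}`. -/
def blockState (W : CQChannel X ι) {n : ℕ} (x : Fin n → X) : Matrix (Fin n → ι) (Fin n → ι) ℂ :=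
  tensorProd fun k => W.state (x k)

/-- The `n`-block output state `P W^n = ∑ x^n, P(x^n) W^n_{x^n}`. -/
def blockOutput (W : CQChannel X ι) {n : ℕ} (P : (Fin n → X) → ℝ) :
    Matrix (Fin n → ι) (Fin n → ι) ℂ :=
  ∑ x, (P x : ℂ) • W.blockState x

variable [DecidableEq ι]

/-- The von Neumann mutual information `I(P;W) = H(PW) - ∑ x, P(x) H(W_x)`. -/
def mutualInfo (b : ℝ) (W : CQChannel X ι) (P : X → ℝ) : ℝ :=
  vonNeumannEntropy b (W.output P) - ∑ x, P x * vonNeumannEntropy b (W.state x)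

/-- The Holevo capacity `C(W) = max_P I(P;W)`, over all probability distributions `P` on `X`. -/
def capacity (b : ℝ) (W : CQChannel X ι) : ℝ :=
  sSup (W.mutualInfo b '' stdSimplex ℝ X)

/-- `(P_i, D_i)`, `i < N`, is an `(n, N, l₁, l₂)` quantum identification code for `W`. -/
structure IsQIDCode (W : CQChannel X ι) (n N : ℕ) (l₁ l₂ : ℝ)
    (P : Fin N → (Fin n → X) → ℝ) (D : Fin N → Matrix (Fin n → ι) (Fin n → ι) ℂ) : Prop where
  prob : ∀ i, P i ∈ stdSimplex ℝ (Fin n → X)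
  nonneg : ∀ i, (D i).PosSemidef
  le_one : ∀ i, (1 - D i).PosSemidef
  first_kind : ∀ i, (W.blockOutput (P i) * (1 - D i)).trace.re ≤ l₁
  second_kind : ∀ i j, i ≠ j → (W.blockOutput (P j) * D i).trace.re ≤ l₂

/-- The sizes `N` for which an `(n, N, l₁, l₂)` quantum identification code exists. -/
def qidSizes (W : CQChannel X ι) (n : ℕ) (l₁ l₂ : ℝ) : Set ℕ :=
  {N | ∃ P D, W.IsQIDCode n N l₁ l₂ P D}

/-- The maximal size `N(n, l₁, l₂)` of a quantum identification code (meaningful when the set of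
sizes is bounded; it always contains `0`). -/
def maxQIDSize (W : CQChannel X ι) (n : ℕ) (l₁ l₂ : ℝ) : ℕ :=
  sSup (W.qidSizes n l₁ l₂)

end CQChannel

/-! ### Classical channels -/

/-- A classical channel: a stochastic matrix `W(y|x)`. -/
structure ClassicalChannel (X Y : Type*) [Fintype X] [Fintype Y] where
  /-- The transition probability `W(y|x)`, with arguments `x` and `y`. -/
  prob : X → Y → ℝ
  prob_mem : ∀ x, prob x ∈ stdSimplex ℝ Y

/-- The Shannon entropy to the base `b`. -/
def shannonEntropy {Y : Type*} [Fintype Y] (b : ℝ) (p : Y → ℝ) : ℝ :=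
  -∑ y, p y * Real.logb b (p y)

namespace ClassicalChannel

variable {X Y : Type*} [Fintype X] [Fintype Y]

/-- The output distribution `PW`. -/
def output (W : ClassicalChannel X Y) (P : X → ℝ) : Y → ℝ :=
  fun y => ∑ x, P x * W.prob x y

/-- Shannon's mutual information `I(P;W) = H(PW) - ∑ x, P(x) H(W(·|x))`. -/
def mutualInfo (b : ℝ) (W : ClassicalChannel X Y) (P : X → ℝ) : ℝ :=
  shannonEntropy b (W.output P) - ∑ x, P x * shannonEntropy b (W.prob x)

/-- The Shannon capacity `C(W) = max_P I(P;W)`. -/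
def capacity (b : ℝ) (W : ClassicalChannel X Y) : ℝ :=
  sSup (W.mutualInfo b '' stdSimplex ℝ X)

/-- The probability `PW^n(A)` of the event `A` under the `n`-block output distribution `PW^n` of the
memoryless channel. -/
def blockProb (W : ClassicalChannel X Y) {n : ℕ} (P : (Fin n → X) → ℝ)
    (A : Finset (Fin n → Y)) : ℝ :=
  ∑ x, P x * ∑ y ∈ A, ∏ k, W.prob (x k) (y k)

variable [DecidableEq Y]

/-- `(P_i, D_i)`, `i < N`, is an `(n, N, l₁, l₂)` identification code for `W`. -/
structure IsIDCode (W : ClassicalChannel X Y) (n N : ℕ) (l₁ l₂ : ℝ)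
    (P : Fin N → (Fin n → X) → ℝ) (D : Fin N → Finset (Fin n → Y)) : Prop where
  prob : ∀ i, P i ∈ stdSimplex ℝ (Fin n → X)
  first_kind : ∀ i, W.blockProb (P i) (D i)ᶜ ≤ l₁
  second_kind : ∀ i j, i ≠ j → W.blockProb (P j) (D i) ≤ l₂

/-- The sizes `N` for which an `(n, N, l₁, l₂)` identification code exists. -/
def idSizes (W : ClassicalChannel X Y) (n : ℕ) (l₁ l₂ : ℝ) : Set ℕ :=
  {N | ∃ P D, W.IsIDCode n N l₁ l₂ P D}

/-- The maximal size `N(n, l₁, l₂)` of an identification code (meaningful when the set of sizes is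
bounded; it always contains `0`). -/
def maxIDSize (W : ClassicalChannel X Y) (n : ℕ) (l₁ l₂ : ℝ) : ℕ :=
  sSup (W.idSizes n l₁ l₂)

end ClassicalChannel

end QID

end

/-!
Up to an error `ε`, the output state `PWⁿ` of every input distribution `P` is the output state of a
uniform distribution on `M = exp (n c)` codewords, for any fixed `c > C(W)` (here `exp` and `C(W)`
are taken to the base `e`). For small `ε` the codes with `l₁ + l₂ < 1` cannot assign two of their
distributions to the same list of codewords, so there are at most `(|X| ^ n) ^ M` of them.

The codewords are sampled. Fix `r` with `C(W) < r < c`. Near-optimality of an input distribution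
yields one state `S` at relative entropy less than `r` from all `W_x`. Large deviations of the
likelihood ratio between the eigenvalues of `Wⁿ_x` and those of `S ⊗ ⋯ ⊗ S`, under the
Nussbaum–Szkoła distribution, are controlled by its moments, which are multiplicative. Truncating
the likelihood ratio at `R = exp (n r)` therefore changes `Wⁿ_x` only slightly, and makes it the
product of the square root of `S ⊗ ⋯ ⊗ S` and an operator of Hilbert–Schmidt norm at most `√R`. The
Hilbert–Schmidt norm is Euclidean, so the average of `M` samples of these operators has error
`√(R / M)`, with no dimension factor, and the Cauchy–Schwarz inequality turns this into a bound on
the trace distance of the states.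
-/

noncomputable section

namespace QID

/-! ### Traces of functions of Hermitian matrices -/

section Trace

open Matrix

variable {κ ν ι : Type*}

theorem sum_norm_sq_row [Fintype ν] (G : Matrix κ ν ℂ) (i : κ) :
    ((∑ j, ‖G i j‖ ^ 2 : ℝ) : ℂ) = (G * Gᴴ) i i := by
  simp [Matrix.mul_apply, Complex.mul_conj, Complex.normSq_eq_norm_sq]

theorem sum_norm_sq_col [Fintype κ] (G : Matrix κ ν ℂ) (j : ν) :
    ((∑ i, ‖G i j‖ ^ 2 : ℝ) : ℂ) = (Gᴴ * G) j j := by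
  simp [Matrix.mul_apply, ← Complex.normSq_eq_conj_mul_self, Complex.normSq_eq_norm_sq]

variable [Fintype ι] [DecidableEq ι] {A B : Matrix ι ι ℂ}

theorem cfc_eq_eigenvectorUnitary_mul_diagonal (hA : A.IsHermitian) (f : ℝ → ℝ) :
    cfc f A = (hA.eigenvectorUnitary : Matrix ι ι ℂ) *
      diagonal (fun i => (f (hA.eigenvalues i) : ℂ)) *
      (hA.eigenvectorUnitary : Matrix ι ι ℂ)ᴴ := by
  rw [hA.cfc_eq, IsHermitian.cfc, Unitary.conjStarAlgAut_apply]
  rfl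

theorem re_trace_cfc (hA : A.IsHermitian) (f : ℝ → ℝ) :
    (cfc f A).trace.re = ∑ i, f (hA.eigenvalues i) := by
  have hU : (hA.eigenvectorUnitary : Matrix ι ι ℂ)ᴴ * (hA.eigenvectorUnitary : Matrix ι ι ℂ) = 1 :=
    Unitary.coe_star_mul_self hA.eigenvectorUnitary
  rw [cfc_eq_eigenvectorUnitary_mul_diagonal hA, trace_mul_cycle, hU, Matrix.one_mul,
    trace_diagonal, ← Complex.ofReal_sum, Complex.ofReal_re]

/-- The unitary matrix of inner products between the eigenvectors of `A` and those of `B`. -/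
def overlap (hA : A.IsHermitian) (hB : B.IsHermitian) : unitaryGroup ι ℂ :=
  star hA.eigenvectorUnitary * hB.eigenvectorUnitary

theorem re_trace_cfc_mul_cfc (hA : A.IsHermitian) (hB : B.IsHermitian) (f g : ℝ → ℝ) :
    (cfc f A * cfc g B).trace.re = ∑ i, ∑ j, ‖(overlap hA hB : Matrix ι ι ℂ) i j‖ ^ 2 *
      (f (hA.eigenvalues i) * g (hB.eigenvalues j)) := by
  have hO : (overlap hA hB : Matrix ι ι ℂ) =
      (hA.eigenvectorUnitary : Matrix ι ι ℂ)ᴴ * (hB.eigenvectorUnitary : Matrix ι ι ℂ) := rfl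
  have htrace : (cfc f A * cfc g B).trace =
      (diagonal (fun i => (f (hA.eigenvalues i) : ℂ)) * (overlap hA hB : Matrix ι ι ℂ) *
        (diagonal (fun j => (g (hB.eigenvalues j) : ℂ)) *
          (overlap hA hB : Matrix ι ι ℂ)ᴴ)).trace := by
    rw [cfc_eq_eigenvectorUnitary_mul_diagonal hA, cfc_eq_eigenvectorUnitary_mul_diagonal hB, hO,
      conjTranspose_mul, conjTranspose_conjTranspose, Matrix.mul_assoc, Matrix.mul_assoc,
      trace_mul_comm]
    simp only [Matrix.mul_assoc]
  rw [htrace, trace, Complex.re_sum]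
  refine Finset.sum_congr rfl fun i _ => ?_
  rw [diag_apply, Matrix.mul_apply, Complex.re_sum]
  refine Finset.sum_congr rfl fun j _ => ?_
  rw [diagonal_mul, diagonal_mul, conjTranspose_apply, Complex.star_def, mul_mul_mul_comm,
    Complex.mul_conj, Complex.normSq_eq_norm_sq, ← Complex.ofReal_mul, ← Complex.ofReal_mul,
    Complex.ofReal_re, mul_comm]

theorem re_trace_mul_nonneg [Fintype κ] {A B : Matrix κ κ ℂ} (hA : A.PosSemidef)
    (hB : B.PosSemidef) : 0 ≤ (A * B).trace.re := by
  classical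
  have h := re_trace_cfc_mul_cfc hA.1 hB.1 (fun x => x) (fun x => x)
  rw [cfc_id' ℝ A hA.1.isSelfAdjoint, cfc_id' ℝ B hB.1.isSelfAdjoint] at h
  rw [h]
  exact Finset.sum_nonneg fun i _ => Finset.sum_nonneg fun j _ => mul_nonneg (sq_nonneg _)
    (mul_nonneg (hA.eigenvalues_nonneg i) (hB.eigenvalues_nonneg j))

theorem mul_cfc_eq_cfc (hA : A.IsHermitian) (f : ℝ → ℝ) :
    A * cfc f A = cfc (fun x => x * f x) A := by
  rw [cfc_mul (fun x => x) f A (finite_real_spectrum.continuousOn _)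
    (finite_real_spectrum.continuousOn _), cfc_id' ℝ A hA.isSelfAdjoint]

theorem cfc_add_smul_one (hA : A.IsHermitian) (f : ℝ → ℝ) (e : ℝ) :
    cfc f (A + e • (1 : Matrix ι ι ℂ)) = cfc (fun x => f (x + e)) A := by
  have h : cfc (fun x : ℝ => x + e) A = A + e • (1 : Matrix ι ι ℂ) := by
    rw [cfc_add_const e (fun x => x) A, cfc_id' ℝ A hA.isSelfAdjoint,
      Algebra.algebraMap_eq_smul_one]
  rw [← h]
  exact (cfc_comp f (fun x => x + e) A hA.isSelfAdjoint
    ((finite_real_spectrum.image _).continuousOn _) (finite_real_spectrum.continuousOn _)).symm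

end Trace

/-! ### Relative entropy -/

section RelEntropy

open Matrix

variable {ι : Type*} [Fintype ι] [DecidableEq ι] {A B ρ σ : Matrix ι ι ℂ}

/-- The quantum relative entropy `Tr ρ (log ρ - log σ)`, in natural units. It is meaningful when
`σ` is positive definite, since `Real.log 0 = 0` makes it finite for every `σ`. -/
def relEntropy (ρ σ : Matrix ι ι ℂ) : ℝ :=
  (ρ * (cfc Real.log ρ - cfc Real.log σ)).trace.re

theorem relEntropy_eq_sub (ρ σ : Matrix ι ι ℂ) :
    relEntropy ρ σ = (ρ * cfc Real.log ρ).trace.re - (ρ * cfc Real.log σ).trace.re := by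
  rw [relEntropy, Matrix.mul_sub, trace_sub, Complex.sub_re]

theorem relEntropy_eq_sum (hρ : ρ.IsHermitian) (hσ : σ.IsHermitian) :
    relEntropy ρ σ = ∑ i, ∑ j, ‖(overlap hσ hρ : Matrix ι ι ℂ) i j‖ ^ 2 *
      (hρ.eigenvalues j * (Real.log (hρ.eigenvalues j) - Real.log (hσ.eigenvalues i))) := by
  have hρρ := re_trace_cfc_mul_cfc hσ hρ (fun _ => 1) (fun x => x * Real.log x)
  have hρσ := re_trace_cfc_mul_cfc hσ hρ Real.log (fun x => x)
  rw [cfc_const_one ℝ σ hσ.isSelfAdjoint, Matrix.one_mul, ← mul_cfc_eq_cfc hρ] at hρρ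
  rw [cfc_id' ℝ ρ hρ.isSelfAdjoint, trace_mul_comm] at hρσ
  rw [relEntropy_eq_sub, hρρ, hρσ, ← Finset.sum_sub_distrib]
  refine Finset.sum_congr rfl fun i _ => ?_
  rw [← Finset.sum_sub_distrib]
  exact Finset.sum_congr rfl fun j _ => by ring

theorem klein_inequality (hρ : ρ.PosSemidef) (hσ : σ.PosDef) :
    ρ.trace.re - σ.trace.re ≤ relEntropy ρ σ := by
  have hlog (i j) : hρ.1.eigenvalues j - hσ.1.eigenvalues i ≤
      hρ.1.eigenvalues j *
        (Real.log (hρ.1.eigenvalues j) - Real.log (hσ.1.eigenvalues i)) := by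
    have hs := hσ.eigenvalues_pos i
    rcases (hρ.eigenvalues_nonneg j).eq_or_lt with hr | hr
    · simpa [← hr] using hs.le
    · have h := mul_le_mul_of_nonneg_left (Real.log_le_sub_one_of_pos (div_pos hs hr)) hr.le
      rw [Real.log_div hs.ne' hr.ne', mul_sub, mul_sub, mul_div_cancel₀ _ hr.ne'] at h
      rw [mul_sub]
      linarith
  have hρtr := re_trace_cfc_mul_cfc hσ.1 hρ.1 (fun _ => 1) (fun x => x)
  have hσtr := re_trace_cfc_mul_cfc hσ.1 hρ.1 (fun x => x) (fun _ => 1)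
  rw [cfc_const_one ℝ σ hσ.1.isSelfAdjoint, cfc_id' ℝ ρ hρ.1.isSelfAdjoint, Matrix.one_mul]
    at hρtr
  rw [cfc_id' ℝ σ hσ.1.isSelfAdjoint, cfc_const_one ℝ ρ hρ.1.isSelfAdjoint, Matrix.mul_one]
    at hσtr
  rw [hρtr, hσtr, relEntropy_eq_sum hρ.1 hσ.1]
  simp only [← Finset.sum_sub_distrib, ← mul_sub, mul_one, one_mul]
  exact Finset.sum_le_sum fun i _ => Finset.sum_le_sum fun j _ =>
    mul_le_mul_of_nonneg_left (hlog i j) (sq_nonneg _)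

theorem relEntropy_le_of_posSemidef_sub (hρ : ρ.PosSemidef) (hA : A.PosDef)
    (hAB : (B - A).PosSemidef) : relEntropy ρ B ≤ relEntropy ρ A := by
  have hlog : (cfc Real.log B - cfc Real.log A).PosSemidef := by
    open scoped Matrix.Norms.L2Operator MatrixOrder in
    exact CFC.log_le_log (a := A) (b := B) (le_iff.2 hAB) hA.isStrictlyPositive
  have h := re_trace_mul_nonneg hρ hlog
  rw [Matrix.mul_sub, trace_sub, Complex.sub_re] at h
  rw [relEntropy_eq_sub, relEntropy_eq_sub]
  linarith

theorem relEntropy_add_smul_one_le (hρ : ρ.PosSemidef) {e : ℝ} (he : 0 ≤ e) :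
    relEntropy ρ (ρ + e • (1 : Matrix ι ι ℂ)) ≤ 0 := by
  have hmono (r : ℝ) (hr : 0 ≤ r) : r * Real.log r ≤ r * Real.log (r + e) := by
    rcases hr.eq_or_lt with rfl | hr
    · simp
    · gcongr
      linarith
  rw [relEntropy_eq_sub, cfc_add_smul_one hρ.1, mul_cfc_eq_cfc hρ.1, mul_cfc_eq_cfc hρ.1,
    re_trace_cfc hρ.1, re_trace_cfc hρ.1, sub_nonpos]
  exact Finset.sum_le_sum fun i _ => hmono _ (hρ.eigenvalues_nonneg i)

theorem relEntropy_smul_right (ρ : Matrix ι ι ℂ) (hσ : σ.PosDef) {t : ℝ} (ht : 0 < t) :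
    relEntropy ρ (t • σ) = relEntropy ρ σ - ρ.trace.re * Real.log t := by
  have hlog : cfc Real.log (t • σ) = Real.log t • (1 : Matrix ι ι ℂ) + cfc Real.log σ := by
    open scoped Matrix.Norms.L2Operator MatrixOrder in
    rw [← Algebra.algebraMap_eq_smul_one]
    exact CFC.log_smul' σ ht hσ.isStrictlyPositive
  rw [relEntropy, relEntropy, hlog, ← sub_sub, sub_right_comm, Matrix.mul_sub, trace_sub,
    Complex.sub_re, Matrix.mul_smul, Matrix.mul_one, trace_smul, Complex.smul_re, smul_eq_mul,
    mul_comm (Real.log t)]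

end RelEntropy

/-! ### Mutual information and capacity -/

theorem vonNeumannEntropy_eq_div_log {ι : Type*} [Fintype ι] [DecidableEq ι] (b : ℝ)
    (ρ : Matrix ι ι ℂ) :
    vonNeumannEntropy b ρ = -(ρ * cfc Real.log ρ).trace.re / Real.log b := by
  have h : cfc (Real.logb b) ρ = (Real.log b)⁻¹ • cfc Real.log ρ := by
    rw [← cfc_smul (Real.log b)⁻¹ Real.log ρ (Matrix.finite_real_spectrum.continuousOn _)]
    congr 1
    funext x
    rw [smul_eq_mul, ← div_eq_inv_mul, Real.log_div_log]
  rw [vonNeumannEntropy, h, Matrix.mul_smul, Matrix.trace_smul, Complex.smul_re, smul_eq_mul,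
    ← div_eq_inv_mul, neg_div]

namespace CQChannel

section Capacity

open Matrix

variable {X ι : Type*} [Fintype X] [Fintype ι]

theorem posSemidef_output (W : CQChannel X ι) {P : X → ℝ} (hP : 0 ≤ P) :
    (W.output P).PosSemidef :=
  posSemidef_sum _ fun x _ => (W.posSemidef x).smul (Complex.zero_le_real.2 (hP x))

theorem trace_output (W : CQChannel X ι) (P : X → ℝ) : (W.output P).trace = ∑ x, (P x : ℂ) := by
  simp [output, trace_sum, W.trace_eq_one]

theorem re_trace_output_mul (W : CQChannel X ι) (P : X → ℝ) (B : Matrix ι ι ℂ) :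
    (W.output P * B).trace.re = ∑ x, P x * (W.state x * B).trace.re := by
  simp [output, Matrix.sum_mul, trace_sum]

theorem re_trace_output_of_mem_stdSimplex (W : CQChannel X ι) {P : X → ℝ}
    (hP : P ∈ stdSimplex ℝ X) : (W.output P).trace.re = 1 := by
  rw [trace_output, ← Complex.ofReal_sum, hP.2, Complex.ofReal_re]

theorem output_sub (W : CQChannel X ι) (P Q : X → ℝ) :
    W.output P - W.output Q = W.output (P - Q) := by
  simp [output, sub_smul]

variable [DecidableEq ι]

theorem mutualInfo_eq_div_log (b : ℝ) (W : CQChannel X ι) (P : X → ℝ) :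
    W.mutualInfo b P = W.mutualInfo (Real.exp 1) P / Real.log b := by
  simp only [mutualInfo, vonNeumannEntropy_eq_div_log _ (W.output P),
    vonNeumannEntropy_eq_div_log _ (W.state _), Real.log_exp, div_one, sub_div, Finset.sum_div,
    mul_div_assoc]

open scoped Pointwise in
theorem capacity_eq_div_log {b : ℝ} (hb : 1 ≤ b) (W : CQChannel X ι) :
    W.capacity b = W.capacity (Real.exp 1) / Real.log b := by
  have himage : W.mutualInfo b '' stdSimplex ℝ X =
      (Real.log b)⁻¹ • (W.mutualInfo (Real.exp 1) '' stdSimplex ℝ X) := by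
    rw [← Set.image_smul, Set.image_image]
    refine Set.image_congr fun P _ => ?_
    rw [mutualInfo_eq_div_log, smul_eq_mul, div_eq_inv_mul]
  rw [capacity, himage, Real.sSup_smul_of_nonneg (inv_nonneg.2 (Real.log_nonneg hb)), smul_eq_mul,
    ← div_eq_inv_mul, capacity]

/-- Donald's identity. -/
theorem sum_mul_relEntropy (W : CQChannel X ι) (P : X → ℝ) (σ : Matrix ι ι ℂ) :
    ∑ x, P x * relEntropy (W.state x) σ =
      W.mutualInfo (Real.exp 1) P + relEntropy (W.output P) σ := by
  simp only [mutualInfo, vonNeumannEntropy_eq_div_log, Real.log_exp, div_one, relEntropy_eq_sub,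
    re_trace_output_mul W P (cfc Real.log σ), mul_sub, mul_neg, Finset.sum_sub_distrib,
    Finset.sum_neg_distrib]
  ring

theorem posDef_output_add_smul_one (W : CQChannel X ι) {P : X → ℝ} (hP : 0 ≤ P) {e : ℝ}
    (he : 0 < e) : (W.output P + e • (1 : Matrix ι ι ℂ)).PosDef :=
  PosDef.posSemidef_add (W.posSemidef_output hP) (PosDef.one.smul he)

theorem neg_le_relEntropy_output_add_smul_one (W : CQChannel X ι) {P : X → ℝ}
    (hP : P ∈ stdSimplex ℝ X) {ρ : Matrix ι ι ℂ} (hρ : ρ.PosSemidef) (hρ₁ : ρ.trace.re = 1)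
    {e : ℝ} (he : 0 < e) :
    -(e * Fintype.card ι) ≤ relEntropy ρ (W.output P + e • (1 : Matrix ι ι ℂ)) := by
  have h := klein_inequality hρ (W.posDef_output_add_smul_one hP.1 he)
  rw [trace_add, Complex.add_re, W.re_trace_output_of_mem_stdSimplex hP, hρ₁, trace_smul,
    trace_one, Complex.smul_re, Complex.natCast_re, smul_eq_mul] at h
  linarith

theorem mutualInfo_nonneg (W : CQChannel X ι) {P : X → ℝ} (hP : P ∈ stdSimplex ℝ X) :
    0 ≤ W.mutualInfo (Real.exp 1) P := by
  have hbound (e : ℝ) (he : 0 < e) : -(e * Fintype.card ι) ≤ W.mutualInfo (Real.exp 1) P := by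
    have hstate (x : X) : -(e * Fintype.card ι) ≤
        relEntropy (W.state x) (W.output P + e • (1 : Matrix ι ι ℂ)) :=
      W.neg_le_relEntropy_output_add_smul_one hP (W.posSemidef x) (by simp [W.trace_eq_one]) he
    calc -(e * Fintype.card ι) = ∑ x, P x * -(e * Fintype.card ι) := by
          rw [← Finset.sum_mul, hP.2, one_mul]
      _ ≤ ∑ x, P x * relEntropy (W.state x) (W.output P + e • (1 : Matrix ι ι ℂ)) :=
          Finset.sum_le_sum fun x _ => mul_le_mul_of_nonneg_left (hstate x) (hP.1 x)
      _ ≤ W.mutualInfo (Real.exp 1) P := by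
          rw [sum_mul_relEntropy]
          exact add_le_of_nonpos_right
            (relEntropy_add_smul_one_le (W.posSemidef_output hP.1) he.le)
  refine le_of_forall_pos_le_add fun ε hε => ?_
  have hd : (0 : ℝ) < Fintype.card ι + 1 := by positivity
  have h := hbound (ε / (Fintype.card ι + 1)) (div_pos hε hd)
  have hle : ε / (Fintype.card ι + 1) * Fintype.card ι ≤ ε := by
    rw [div_mul_eq_mul_div, div_le_iff₀ hd]
    linarith
  linarith

theorem capacity_nonneg (W : CQChannel X ι) : 0 ≤ W.capacity (Real.exp 1) :=
  Real.sSup_nonneg (Set.forall_mem_image.2 fun _ hP => W.mutualInfo_nonneg hP)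

theorem bddAbove_mutualInfo (W : CQChannel X ι) :
    BddAbove (W.mutualInfo (Real.exp 1) '' stdSimplex ℝ X) := by
  refine ⟨∑ x, |relEntropy (W.state x) 1| - (1 - Fintype.card ι), ?_⟩
  rintro _ ⟨P, hP, rfl⟩
  have hklein := klein_inequality (W.posSemidef_output hP.1) PosDef.one
  rw [W.re_trace_output_of_mem_stdSimplex hP, trace_one, Complex.natCast_re] at hklein
  have hsum : ∑ x, P x * relEntropy (W.state x) 1 ≤ ∑ x, |relEntropy (W.state x) 1| := by
    refine Finset.sum_le_sum fun x _ => (le_abs_self _).trans ?_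
    obtain ⟨hPx₀, hPx₁⟩ := mem_Icc_of_mem_stdSimplex hP x
    rw [abs_mul, abs_of_nonneg hPx₀]
    exact mul_le_of_le_one_left (abs_nonneg _) hPx₁
  rw [sum_mul_relEntropy] at hsum
  linarith

theorem mutualInfo_le_capacity (W : CQChannel X ι) {P : X → ℝ} (hP : P ∈ stdSimplex ℝ X) :
    W.mutualInfo (Real.exp 1) P ≤ W.capacity (Real.exp 1) :=
  le_csSup W.bddAbove_mutualInfo (Set.mem_image_of_mem _ hP)

theorem mul_relEntropy_mixture_le (W : CQChannel X ι) [DecidableEq X] {P : X → ℝ}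
    (hP : P ∈ stdSimplex ℝ X) (x : X) {t e : ℝ} (ht₀ : 0 ≤ t) (ht₁ : t ≤ 1) (he : 0 < e) :
    t * relEntropy (W.state x)
        (W.output ((1 - t) • P + t • Pi.single x 1) + e • (1 : Matrix ι ι ℂ)) ≤
      W.capacity (Real.exp 1) -
        (1 - t) * (W.mutualInfo (Real.exp 1) P - e * Fintype.card ι) := by
  have hP' : (1 - t) • P + t • Pi.single x 1 ∈ stdSimplex ℝ X :=
    convex_stdSimplex ℝ X hP (single_mem_stdSimplex ℝ x) (sub_nonneg.2 ht₁) ht₀ (by ring)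
  set P' := (1 - t) • P + t • Pi.single x 1
  set S := W.output P' + e • (1 : Matrix ι ι ℂ)
  have hsplit : ∑ y, P' y * relEntropy (W.state y) S =
      (1 - t) * ∑ y, P y * relEntropy (W.state y) S + t * relEntropy (W.state x) S := by
    simp [P', add_mul, Finset.sum_add_distrib, Finset.mul_sum, mul_assoc, Pi.single_apply]
  have hupper : ∑ y, P' y * relEntropy (W.state y) S ≤ W.capacity (Real.exp 1) := by
    rw [sum_mul_relEntropy]
    linarith [W.mutualInfo_le_capacity hP',
      relEntropy_add_smul_one_le (W.posSemidef_output hP'.1) he.le]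
  have hlower : W.mutualInfo (Real.exp 1) P - e * Fintype.card ι ≤
      ∑ y, P y * relEntropy (W.state y) S := by
    rw [sum_mul_relEntropy]
    linarith [W.neg_le_relEntropy_output_add_smul_one hP' (W.posSemidef_output hP.1)
      (W.re_trace_output_of_mem_stdSimplex hP) he]
  linarith [mul_le_mul_of_nonneg_left hlower (sub_nonneg.2 ht₁)]

/-- Mixing a nearly optimal output state with a bit of every `W_x` and of the identity gives a
single state which is at relative entropy nearly `C(W)` from every `W_x`. -/
theorem exists_posDef_relEntropy_le_add [Nonempty X] (W : CQChannel X ι) {t : ℝ} (ht₀ : 0 < t)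
    (ht₁ : t ≤ 1) : ∃ S : Matrix ι ι ℂ, S.PosDef ∧
      S.trace.re ≤ 1 + t * (Fintype.card X + Fintype.card ι) ∧
      ∀ x, relEntropy (W.state x) S ≤ W.capacity (Real.exp 1) + t * (1 + Fintype.card ι) := by
  classical
  obtain ⟨_, ⟨P, hP, rfl⟩, hPC⟩ := exists_lt_of_lt_csSup
    ((Set.nonempty_of_mem (single_mem_stdSimplex ℝ (Classical.arbitrary X))).image
      (W.mutualInfo (Real.exp 1)))
    (sub_lt_self (W.capacity (Real.exp 1)) (sq_pos_of_pos ht₀))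
  have ht₂ : 0 ≤ 1 - t := sub_nonneg.2 ht₁
  have ht₃ : t ^ 2 ≤ t := by nlinarith
  have hmixture : 0 ≤ (1 - t) • P + t • (1 : X → ℝ) :=
    add_nonneg (smul_nonneg ht₂ hP.1) (smul_nonneg ht₀.le zero_le_one)
  refine ⟨W.output ((1 - t) • P + t • 1) + t ^ 2 • 1,
    W.posDef_output_add_smul_one hmixture (by positivity), ?_, fun x => ?_⟩
  · have htrace : (W.output ((1 - t) • P + t • 1) + t ^ 2 • (1 : Matrix ι ι ℂ)).trace.re =
        (1 - t) + t * Fintype.card X + t ^ 2 * Fintype.card ι := by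
      rw [trace_add, Complex.add_re, trace_output, ← Complex.ofReal_sum, Complex.ofReal_re,
        trace_smul, Complex.smul_re, trace_one, Complex.natCast_re, smul_eq_mul]
      simp [Finset.sum_add_distrib, ← Finset.mul_sum, hP.2, mul_comm t]
    have := mul_le_mul_of_nonneg_right ht₃ (Fintype.card ι).cast_nonneg (α := ℝ)
    rw [htrace]
    linarith
  · have hle : (Pi.single x 1 : X → ℝ) ≤ 1 := fun y =>
      (mem_Icc_of_mem_stdSimplex (single_mem_stdSimplex ℝ x) y).2
    have hsingle : 0 ≤ (1 - t) • P + t • (Pi.single x 1 : X → ℝ) :=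
      add_nonneg (smul_nonneg ht₂ hP.1) (smul_nonneg ht₀.le (Pi.single_nonneg.2 zero_le_one))
    have hmono := relEntropy_le_of_posSemidef_sub (W.posSemidef x)
      (W.posDef_output_add_smul_one hsingle (sq_pos_of_pos ht₀))
      (B := W.output ((1 - t) • P + t • 1) + t ^ 2 • 1) (by
        rw [add_sub_add_right_eq_sub, output_sub, add_sub_add_left_eq_sub, ← smul_sub]
        exact W.posSemidef_output (smul_nonneg ht₀.le (sub_nonneg.2 hle)))
    have hmul := W.mul_relEntropy_mixture_le hP x ht₀.le ht₁ (sq_pos_of_pos ht₀)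
    have hbound := mul_le_mul_of_nonneg_left hPC.le ht₂
    refine hmono.trans (le_of_mul_le_mul_left (hmul.trans ?_) ht₀)
    have hcube : 0 ≤ t * (t ^ 2 * (1 + Fintype.card ι)) := by positivity
    linarith

theorem exists_posDef_relEntropy_lt [Nonempty X] (W : CQChannel X ι) {c : ℝ}
    (hc : W.capacity (Real.exp 1) < c) :
    ∃ S : Matrix ι ι ℂ, S.PosDef ∧ S.trace = 1 ∧ ∀ x, relEntropy (W.state x) S < c := by
  obtain ⟨x₀⟩ := ‹Nonempty X›
  have : Nonempty ι := not_isEmpty_iff.1 fun _ => by simpa using W.trace_eq_one x₀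
  set K : ℝ := 2 + 2 * Fintype.card ι + Fintype.card X with hK
  have hKpos : 0 < K := by positivity
  set t := min 1 ((c - W.capacity (Real.exp 1)) / K)
  have ht₀ : 0 < t := lt_min one_pos (div_pos (sub_pos.2 hc) hKpos)
  have htK : t * K ≤ c - W.capacity (Real.exp 1) := (le_div_iff₀ hKpos).1 (min_le_right _ _)
  obtain ⟨S, hS, htrace, hrel⟩ := W.exists_posDef_relEntropy_le_add ht₀ (min_le_left _ _)
  obtain ⟨hτ, hτS⟩ := Complex.pos_iff.1 hS.trace_pos
  have hlog := (Real.log_le_sub_one_of_pos hτ).trans (sub_le_sub_right htrace 1)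
  refine ⟨S.trace.re⁻¹ • S, hS.smul (inv_pos.2 hτ), ?_, fun x => ?_⟩
  · rw [trace_smul]
    apply Complex.ext <;> simp [hτ.ne', ← hτS]
  · rw [relEntropy_smul_right _ hS (inv_pos.2 hτ), W.trace_eq_one, Complex.one_re, one_mul,
      Real.log_inv, sub_neg_eq_add]
    rw [hK] at htK
    linarith [hrel x]

end Capacity

end CQChannel

/-! ### Sampling in a Hilbert space -/

section Sampling

variable {A E : Type*} [Fintype A]

theorem exists_le_sum_mul_of_mem_stdSimplex {P : A → ℝ} (hP : P ∈ stdSimplex ℝ A) (g : A → ℝ) :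
    ∃ a, g a ≤ ∑ a, P a * g a := by
  have : Nonempty A := not_isEmpty_iff.1 fun _ => by simpa using hP.2
  obtain ⟨a, ha⟩ := Finite.exists_min g
  refine ⟨a, ?_⟩
  calc g a = ∑ a', P a' * g a := by rw [← Finset.sum_mul, hP.2, one_mul]
    _ ≤ ∑ a', P a' * g a' :=
        Finset.sum_le_sum fun a' _ => mul_le_mul_of_nonneg_left (ha a') (hP.1 a')

theorem sum_mul_le_of_mem_stdSimplex {P : A → ℝ} (hP : P ∈ stdSimplex ℝ A) {g : A → ℝ} {C : ℝ}
    (hg : ∀ a, g a ≤ C) : ∑ a, P a * g a ≤ C :=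
  calc ∑ a, P a * g a ≤ ∑ a, P a * C :=
        Finset.sum_le_sum fun a _ => mul_le_mul_of_nonneg_left (hg a) (hP.1 a)
    _ = C := by rw [← Finset.sum_mul, hP.2, one_mul]

theorem const_inv_mem_stdSimplex {M : ℕ} (hM : 0 < M) :
    (fun _ => (M : ℝ)⁻¹) ∈ stdSimplex ℝ (Fin M) :=
  ⟨fun _ => by positivity, by simp [hM.ne']⟩

variable [NormedAddCommGroup E] [InnerProductSpace ℝ E]

theorem sum_mul_norm_add_sub_mean_sq {P : A → ℝ} (hP : P ∈ stdSimplex ℝ A) (v : A → E) (S : E) :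
    ∑ a, P a * ‖S + (v a - ∑ a', P a' • v a')‖ ^ 2 =
      ‖S‖ ^ 2 + ∑ a, P a * ‖v a‖ ^ 2 - ‖∑ a, P a • v a‖ ^ 2 := by
  set μ := ∑ a', P a' • v a' with hμ
  have hexpand (a : A) : P a * ‖S + (v a - μ)‖ ^ 2 =
      P a * ‖S - μ‖ ^ 2 + 2 * inner ℝ (S - μ) (P a • v a) + P a * ‖v a‖ ^ 2 := by
    rw [← add_sub_assoc, add_sub_right_comm, norm_add_sq_real, inner_smul_right]
    ring
  have hS : ‖S‖ ^ 2 = ‖S - μ‖ ^ 2 + 2 * inner ℝ (S - μ) μ + ‖μ‖ ^ 2 := by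
    rw [← norm_add_sq_real, sub_add_cancel]
  simp only [hexpand, Finset.sum_add_distrib, ← Finset.mul_sum, ← inner_sum, ← hμ, hS,
    ← Finset.sum_mul, hP.2]
  ring

theorem exists_norm_sum_sub_mean_sq_le {P : A → ℝ} (hP : P ∈ stdSimplex ℝ A) {v : A → E} {r : ℝ}
    (hv : ∀ a, ‖v a‖ ≤ r) (M : ℕ) :
    ∃ f : Fin M → A, ‖∑ m, (v (f m) - ∑ a, P a • v a)‖ ^ 2 ≤ M * r ^ 2 := by
  induction M with
  | zero => exact ⟨Fin.elim0, by simp⟩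
  | succ M ih =>
    obtain ⟨f, hf⟩ := ih
    obtain ⟨a, ha⟩ := exists_le_sum_mul_of_mem_stdSimplex hP fun a =>
      ‖∑ m, (v (f m) - ∑ a, P a • v a) + (v a - ∑ a, P a • v a)‖ ^ 2
    rw [sum_mul_norm_add_sub_mean_sq hP] at ha
    have hr : ∑ a, P a * ‖v a‖ ^ 2 ≤ r ^ 2 :=
      sum_mul_le_of_mem_stdSimplex hP fun a => pow_le_pow_left₀ (norm_nonneg _) (hv a) 2
    refine ⟨Fin.snoc f a, ?_⟩
    simp only [Fin.sum_univ_castSucc, Fin.snoc_castSucc, Fin.snoc_last]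
    push_cast
    linarith [sq_nonneg ‖∑ a, P a • v a‖]

/-- Maurey's empirical method, derandomised: the `f m` are chosen one after the other. -/
theorem exists_norm_average_sub_mean_le {P : A → ℝ} (hP : P ∈ stdSimplex ℝ A) {v : A → E} {r : ℝ}
    (hv : ∀ a, ‖v a‖ ≤ r) {M : ℕ} (hM : 0 < M) :
    ∃ f : Fin M → A, ‖∑ m, (M : ℝ)⁻¹ • v (f m) - ∑ a, P a • v a‖ ≤ r / √M := by
  obtain ⟨a₀, -⟩ := exists_le_sum_mul_of_mem_stdSimplex hP 0
  have hr : 0 ≤ r := (norm_nonneg _).trans (hv a₀)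
  obtain ⟨f, hf⟩ := exists_norm_sum_sub_mean_sq_le hP hv M
  have hM' : (0 : ℝ) < M := Nat.cast_pos.2 hM
  have haverage : ∑ m, (M : ℝ)⁻¹ • v (f m) - ∑ a, P a • v a =
      (M : ℝ)⁻¹ • ∑ m, (v (f m) - ∑ a, P a • v a) := by
    rw [Finset.sum_sub_distrib, smul_sub, Finset.smul_sum, Finset.sum_const, Finset.card_univ,
      Fintype.card_fin, ← Nat.cast_smul_eq_nsmul ℝ, smul_smul, inv_mul_cancel₀ hM'.ne', one_smul]
  refine ⟨f, (sq_le_sq₀ (norm_nonneg _) (by positivity)).1 ?_⟩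
  rw [haverage, norm_smul, mul_pow, Real.norm_eq_abs, sq_abs, div_pow, Real.sq_sqrt hM'.le]
  calc (M : ℝ)⁻¹ ^ 2 * ‖∑ m, (v (f m) - ∑ a, P a • v a)‖ ^ 2
      ≤ (M : ℝ)⁻¹ ^ 2 * (M * r ^ 2) := by gcongr
    _ = r ^ 2 / M := by field_simp

end Sampling

/-! ### One-shot covering -/

section Covering

open Matrix

attribute [local instance] Matrix.frobeniusNormedAddCommGroup Matrix.frobeniusNormedSpace

variable {A J : Type*} [Fintype A] [Fintype J]

theorem frobenius_norm_sq (Y : Matrix J J ℂ) : ‖Y‖ ^ 2 = ∑ i, ∑ j, ‖Y i j‖ ^ 2 := by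
  have h : 0 ≤ ∑ i, ∑ j, ‖Y i j‖ ^ 2 := by positivity
  simp only [frobenius_norm_def, Real.rpow_two, ← Real.sqrt_eq_rpow, Real.sq_sqrt h]

theorem frobenius_norm_sq_eq_re_trace (Y : Matrix J J ℂ) : ‖Y‖ ^ 2 = (Y * Yᴴ).trace.re := by
  simp only [frobenius_norm_sq, trace, diag_apply, ← sum_norm_sq_row, ← Complex.ofReal_sum,
    Complex.ofReal_re]

/-- The real Hilbert–Schmidt inner product `Re Tr (Aᴴ B)`, whose norm is the Frobenius norm. -/
@[reducible]
def frobeniusInnerProductSpace : InnerProductSpace ℝ (Matrix J J ℂ) where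
  inner A B := (Aᴴ * B).trace.re
  norm_sq_eq_re_inner A := by
    rw [← frobenius_norm_conjTranspose, frobenius_norm_sq_eq_re_trace, conjTranspose_conjTranspose]
    rfl
  conj_inner_symm A B := by
    rw [conj_trivial, ← Complex.conj_re, ← Complex.star_def, ← trace_conjTranspose,
      conjTranspose_mul, conjTranspose_conjTranspose]
  add_left A B C := by
    rw [conjTranspose_add, Matrix.add_mul, trace_add, Complex.add_re]
  smul_left A B r := by
    simp [conjTranspose_smul]

attribute [local instance] frobeniusInnerProductSpace

theorem abs_re_trace_mul_le (Y Z : Matrix J J ℂ) : |(Y * Z).trace.re| ≤ ‖Y‖ * ‖Z‖ := by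
  have h := abs_real_inner_le_norm Yᴴ Z
  rwa [frobenius_norm_conjTranspose, show inner ℝ Yᴴ Z = (Yᴴᴴ * Z).trace.re from rfl,
    conjTranspose_conjTranspose] at h

/-- The part of `G` on the entries where the likelihood ratio `w j / s i` is at most `R`. -/
def truncate (G : Matrix J J ℂ) (w s : J → ℝ) (R : ℝ) : Matrix J J ℂ :=
  of fun i j => if w j ≤ R * s i then G i j else 0

/-- The moment of order `θ` of the likelihood ratio `w j / s i` under the distribution `|G i j| ^ 2`
of Nussbaum and Szkoła. For states `ρ` and `σ` with eigenvalues `w` and `s`, and `G` as in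
`sqrtOverlap`, it is `Tr (ρ ^ (1 + θ) σ ^ (-θ))`. -/
def likelihoodMoment (G : Matrix J J ℂ) (w s : J → ℝ) (θ : ℝ) : ℝ :=
  ∑ i, ∑ j, ‖G i j‖ ^ 2 * (w j / s i) ^ θ

theorem frobenius_norm_sub_truncate_sq_le {G : Matrix J J ℂ} {w s : J → ℝ} {R θ : ℝ}
    (hw : 0 ≤ w) (hs : ∀ i, 0 < s i) (hR : 0 < R) (hθ : 0 ≤ θ) :
    ‖G - truncate G w s R‖ ^ 2 ≤ (R ^ θ)⁻¹ * likelihoodMoment G w s θ := by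
  rw [frobenius_norm_sq, likelihoodMoment, Finset.mul_sum]
  refine Finset.sum_le_sum fun i _ => ?_
  rw [Finset.mul_sum]
  refine Finset.sum_le_sum fun j _ => ?_
  have hratio : 0 ≤ w j / s i := div_nonneg (hw j) (hs i).le
  by_cases h : w j ≤ R * s i
  · rw [Matrix.sub_apply, truncate, of_apply, if_pos h, sub_self, norm_zero, zero_pow two_ne_zero]
    positivity
  · have hle : R ^ θ ≤ (w j / s i) ^ θ :=
      Real.rpow_le_rpow hR.le ((le_div_iff₀ (hs i)).2 (not_le.1 h).le) hθ
    rw [Matrix.sub_apply, truncate, of_apply, if_neg h, sub_zero, mul_left_comm]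
    exact le_mul_of_one_le_right (sq_nonneg _)
      ((one_le_inv_mul₀ (Real.rpow_pos_of_pos hR θ)).2 hle)

variable [DecidableEq J]

/-- `A` and `B` are indistinguishable up to `η` by the measurement of an effect `0 ≤ D ≤ 1`; for
states this is the trace distance. -/
def EffectClose (η : ℝ) (A B : Matrix J J ℂ) : Prop :=
  ∀ D : Matrix J J ℂ, D.PosSemidef → (1 - D).PosSemidef → |((A - B) * D).trace.re| ≤ η

theorem posSemidef_one_sub_mul_self {D : Matrix J J ℂ} (hD : D.PosSemidef)
    (hD₁ : (1 - D).PosSemidef) : (1 - D * D).PosSemidef := by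
  have h : 1 - D * D = (1 - D) + (Dᴴ * (1 - D) * D + (1 - D)ᴴ * D * (1 - D)) := by
    rw [hD.1, hD₁.1]
    noncomm_ring
  rw [h]
  exact hD₁.add ((hD₁.conjTranspose_mul_mul_same D).add (hD.conjTranspose_mul_mul_same (1 - D)))

theorem frobenius_norm_mul_effect_le {D : Matrix J J ℂ} (hD : D.PosSemidef)
    (hD₁ : (1 - D).PosSemidef) (Y : Matrix J J ℂ) : ‖Y * D‖ ≤ ‖Y‖ := by
  have h := re_trace_mul_nonneg (posSemidef_conjTranspose_mul_self Y)
    (posSemidef_one_sub_mul_self hD hD₁)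
  rw [Matrix.mul_sub, Matrix.mul_one, trace_sub, Complex.sub_re, sub_nonneg] at h
  refine (sq_le_sq₀ (norm_nonneg _) (norm_nonneg _)).1 ?_
  rw [frobenius_norm_sq_eq_re_trace, frobenius_norm_sq_eq_re_trace, trace_mul_comm Y,
    conjTranspose_mul, hD.1, ← Matrix.mul_assoc, trace_mul_comm]
  simpa only [Matrix.mul_assoc] using h

namespace EffectClose

variable {η η' : ℝ} {B C Y Z V : Matrix J J ℂ}

theorem of_sub_eq_mul {A : Matrix J J ℂ} (h : A - B = Y * Z) (hη : ‖Y‖ * ‖Z‖ ≤ η) :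
    EffectClose η A B := by
  intro D hD hD₁
  rw [h, Matrix.mul_assoc]
  calc |(Y * (Z * D)).trace.re| ≤ ‖Y‖ * ‖Z * D‖ := abs_re_trace_mul_le _ _
    _ ≤ ‖Y‖ * ‖Z‖ := by
        gcongr
        exact frobenius_norm_mul_effect_le hD hD₁ Z
    _ ≤ η := hη

theorem symm {A : Matrix J J ℂ} (h : EffectClose η A B) : EffectClose η B A := by
  intro D hD hD₁
  rw [← neg_sub A B, Matrix.neg_mul, trace_neg, Complex.neg_re, abs_neg]
  exact h D hD hD₁

theorem trans {A : Matrix J J ℂ} (hAB : EffectClose η A B) (hBC : EffectClose η' B C) :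
    EffectClose (η + η') A C := by
  intro D hD hD₁
  rw [← sub_add_sub_cancel A B C, Matrix.add_mul, trace_add, Complex.add_re]
  exact (abs_add_le _ _).trans (add_le_add (hAB D hD hD₁) (hBC D hD hD₁))

theorem sum_smul {F G : A → Matrix J J ℂ} {p : A → ℝ} (hp : p ∈ stdSimplex ℝ A)
    (h : ∀ a, EffectClose η (F a) (G a)) :
    EffectClose η (∑ a, p a • F a) (∑ a, p a • G a) := by
  intro D hD hD₁
  rw [← Finset.sum_sub_distrib, Finset.sum_mul, trace_sum, Complex.re_sum]
  simp only [← smul_sub, smul_mul_assoc, trace_smul, Complex.smul_re, smul_eq_mul]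
  refine (Finset.abs_sum_le_sum_abs _ _).trans ?_
  simp only [abs_mul, abs_of_nonneg (hp.1 _)]
  exact sum_mul_le_of_mem_stdSimplex hp fun a => h a D hD hD₁

theorem of_conj {A : Matrix J J ℂ} (hV : Vᴴ * V = 1)
    (h : EffectClose η (Vᴴ * A * V) (Vᴴ * B * V)) : EffectClose η A B := by
  intro D hD hD₁
  have hV' : V * Vᴴ = 1 := mul_eq_one_comm.1 hV
  have hconj := h (Vᴴ * D * V) (hD.conjTranspose_mul_mul_same V) (by
    have := hD₁.conjTranspose_mul_mul_same V
    rwa [Matrix.mul_sub, Matrix.sub_mul, Matrix.mul_one, hV] at this)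
  have htrace : ((Vᴴ * A * V - Vᴴ * B * V) * (Vᴴ * D * V)).trace = ((A - B) * D).trace :=
    calc ((Vᴴ * A * V - Vᴴ * B * V) * (Vᴴ * D * V)).trace
        = (Vᴴ * ((A - B) * (V * Vᴴ) * D) * V).trace := by
          simp only [← Matrix.sub_mul, ← Matrix.mul_sub, Matrix.mul_assoc]
      _ = ((A - B) * D).trace := by
          rw [trace_mul_cycle, hV', Matrix.one_mul, Matrix.mul_one]
  rwa [htrace] at hconj

end EffectClose

/-- If `K a (K a)ᴴ` is close to `Q Z a` with a common factor `Q`, then sampling the `Z a` in the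
Hilbert–Schmidt norm samples the `K a (K a)ᴴ` in the sense of `EffectClose`. -/
theorem exists_effectClose_average {K T Z : A → Matrix J J ℂ} {Q : Matrix J J ℂ} {ε r : ℝ}
    (hK : ∀ a, ‖K a‖ ≤ 1) (hKT : ∀ a, ‖K a - T a‖ ≤ ε) (hT : ∀ a, T a * (K a)ᴴ = Q * Z a)
    (hQ : ‖Q‖ ≤ 1) (hZ : ∀ a, ‖Z a‖ ≤ r) {P : A → ℝ} (hP : P ∈ stdSimplex ℝ A) {M : ℕ}
    (hM : 0 < M) :
    ∃ f : Fin M → A, EffectClose (ε + r / √M + ε) (∑ m, (M : ℝ)⁻¹ • (K (f m) * (K (f m))ᴴ))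
      (∑ a, P a • (K a * (K a)ᴴ)) := by
  obtain ⟨f, hf⟩ := exists_norm_average_sub_mean_le hP hZ hM
  have htruncate (a : A) : EffectClose ε (K a * (K a)ᴴ) (T a * (K a)ᴴ) := by
    refine .of_sub_eq_mul (Matrix.sub_mul _ _ _).symm ?_
    rw [frobenius_norm_conjTranspose]
    exact (mul_le_of_le_one_right (norm_nonneg _) (hK a)).trans (hKT a)
  have hsample : EffectClose (r / √M) (∑ m, (M : ℝ)⁻¹ • (T (f m) * (K (f m))ᴴ))
      (∑ a, P a • (T a * (K a)ᴴ)) := by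
    refine .of_sub_eq_mul (Y := Q)
      (Z := ∑ m, (M : ℝ)⁻¹ • Z (f m) - ∑ a, P a • Z a) ?_ ?_
    · simp only [hT, Matrix.mul_sub, Matrix.mul_sum, Matrix.mul_smul]
    · exact (mul_le_of_le_one_left (norm_nonneg _) hQ).trans hf
  exact ⟨f, ((EffectClose.sum_smul (const_inv_mem_stdSimplex hM) fun m => htruncate (f m)).trans
    hsample).trans (EffectClose.sum_smul hP htruncate).symm⟩

variable {G : Matrix J J ℂ} {w s : J → ℝ} {R : ℝ}

theorem frobenius_norm_mul_conjTranspose_sq (hG : Gᴴ * G = diagonal fun j => (w j : ℂ))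
    (Y : Matrix J J ℂ) : ‖Y * Gᴴ‖ ^ 2 = ∑ i, ∑ j, ‖Y i j‖ ^ 2 * w j := by
  have hmul : Y * Gᴴ * (Y * Gᴴ)ᴴ = Y * diagonal (fun j => (w j : ℂ)) * Yᴴ := by
    rw [conjTranspose_mul, conjTranspose_conjTranspose, ← hG]
    simp only [Matrix.mul_assoc]
  rw [frobenius_norm_sq_eq_re_trace, hmul, trace, Complex.re_sum]
  refine Finset.sum_congr rfl fun i _ => ?_
  rw [diag_apply, Matrix.mul_apply, Complex.re_sum]
  refine Finset.sum_congr rfl fun j _ => ?_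
  rw [mul_diagonal, conjTranspose_apply, Complex.star_def, mul_right_comm, Complex.mul_conj,
    Complex.normSq_eq_norm_sq, ← Complex.ofReal_mul, Complex.ofReal_re]

theorem frobenius_norm_eq_one (hG : Gᴴ * G = diagonal fun j => (w j : ℂ)) (hw : ∑ j, w j = 1) :
    ‖G‖ = 1 := by
  rw [← sq_eq_sq₀ (norm_nonneg _) zero_le_one, ← frobenius_norm_conjTranspose,
    frobenius_norm_sq_eq_re_trace, conjTranspose_conjTranspose, hG, trace_diagonal,
    ← Complex.ofReal_sum, hw, Complex.ofReal_re, one_pow]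

theorem frobenius_norm_diagonal_sqrt_le_one (hs : 0 ≤ s) (hs₁ : ∑ i, s i ≤ 1) :
    ‖(diagonal fun i => ((√(s i) : ℝ) : ℂ) : Matrix J J ℂ)‖ ≤ 1 := by
  rw [← sq_le_one_iff₀ (norm_nonneg _), frobenius_norm_sq_eq_re_trace, diagonal_conjTranspose,
    diagonal_mul_diagonal, trace_diagonal, Complex.re_sum]
  refine le_trans (Finset.sum_le_sum fun i _ => ?_) hs₁
  simp [← Complex.ofReal_mul, Real.mul_self_sqrt (hs i)]

theorem frobenius_norm_inv_sqrt_mul_truncate_le (hs : ∀ i, 0 < s i) (hR : 0 ≤ R)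
    (hG : Gᴴ * G = diagonal fun j => (w j : ℂ)) (hw : ∑ j, w j = 1) :
    ‖diagonal (fun i => (((√(s i))⁻¹ : ℝ) : ℂ)) * truncate G w s R * Gᴴ‖ ≤ √R := by
  refine Real.le_sqrt_of_sq_le ?_
  calc ‖diagonal (fun i => (((√(s i))⁻¹ : ℝ) : ℂ)) * truncate G w s R * Gᴴ‖ ^ 2
      = ∑ i, ∑ j, (s i)⁻¹ * ‖truncate G w s R i j‖ ^ 2 * w j := by
        simp only [frobenius_norm_mul_conjTranspose_sq hG, diagonal_mul, norm_mul, mul_pow,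
          Complex.norm_real, Real.norm_eq_abs, sq_abs, inv_pow, Real.sq_sqrt (hs _).le]
    _ ≤ ∑ i, ∑ j, R * ‖G i j‖ ^ 2 := by
        refine Finset.sum_le_sum fun i _ => Finset.sum_le_sum fun j _ => ?_
        by_cases h : w j ≤ R * s i
        · rw [truncate, of_apply, if_pos h, mul_right_comm, inv_mul_eq_div]
          gcongr
          exact (div_le_iff₀ (hs i)).2 h
        · rw [truncate, of_apply, if_neg h, norm_zero, zero_pow two_ne_zero, mul_zero, zero_mul]
          positivity
    _ = R := by
        simp only [← Finset.mul_sum, ← frobenius_norm_sq, frobenius_norm_eq_one hG hw, one_pow,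
          mul_one]

theorem exists_effectClose_average_of_likelihoodMoment_le {G : A → Matrix J J ℂ} {w : A → J → ℝ}
    {θ ε : ℝ} (hs : ∀ i, 0 < s i) (hs₁ : ∑ i, s i ≤ 1) (hw : ∀ a, 0 ≤ w a)
    (hw₁ : ∀ a, ∑ j, w a j = 1) (hG : ∀ a, (G a)ᴴ * G a = diagonal fun j => (w a j : ℂ))
    (hR : 0 < R) (hθ : 0 ≤ θ) (hε : 0 ≤ ε)
    (hmoment : ∀ a, likelihoodMoment (G a) (w a) s θ ≤ R ^ θ * ε ^ 2)
    {P : A → ℝ} (hP : P ∈ stdSimplex ℝ A) {M : ℕ} (hM : 0 < M) :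
    ∃ f : Fin M → A, EffectClose (ε + √R / √M + ε)
      (∑ m, (M : ℝ)⁻¹ • (G (f m) * (G (f m))ᴴ)) (∑ a, P a • (G a * (G a)ᴴ)) := by
  have htail (a : A) : ‖G a - truncate (G a) (w a) s R‖ ≤ ε := by
    refine (sq_le_sq₀ (norm_nonneg _) hε).1
      ((frobenius_norm_sub_truncate_sq_le (hw a) hs hR hθ).trans ?_)
    exact (inv_mul_le_iff₀ (Real.rpow_pos_of_pos hR θ)).2 (hmoment a)
  refine exists_effectClose_average (Q := diagonal fun i => ((√(s i) : ℝ) : ℂ))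
    (fun a => (frobenius_norm_eq_one (hG a) (hw₁ a)).le) htail (fun a => ?_)
    (frobenius_norm_diagonal_sqrt_le_one (fun i => (hs i).le) hs₁)
    (fun a => frobenius_norm_inv_sqrt_mul_truncate_le hs hR.le (hG a) (hw₁ a)) hP hM
  have hinv (i : J) : ((√(s i) : ℝ) : ℂ) * (((√(s i))⁻¹ : ℝ) : ℂ) = 1 := by
    rw [← Complex.ofReal_mul, mul_inv_cancel₀ (Real.sqrt_ne_zero'.2 (hs i)), Complex.ofReal_one]
  rw [← Matrix.mul_assoc, ← Matrix.mul_assoc, diagonal_mul_diagonal]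
  simp only [hinv, diagonal_one, Matrix.one_mul]

end Covering

/-! ### Likelihood moments -/

section LikelihoodMoment

open Matrix Filter Topology

theorem eventually_sum_mul_exp_le {Ω : Type*} [Fintype Ω] {q l : Ω → ℝ} (hq : ∑ o, q o = 1)
    {c : ℝ} (hc : ∑ o, q o * l o < c) :
    ∀ᶠ θ : ℝ in 𝓝[>] 0, ∑ o, q o * Real.exp (θ * l o) ≤ Real.exp (θ * c) := by
  set F : ℝ → ℝ := fun θ => Real.exp (θ * c) - ∑ o, q o * Real.exp (θ * l o)
  have hF₀ : F 0 = 0 := by simp [F, hq]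
  have hexp (t : ℝ) : HasDerivAt (fun θ : ℝ => Real.exp (θ * t)) t 0 := by
    simpa using ((hasDerivAt_id (0 : ℝ)).mul_const t).exp
  have hF : HasDerivAt F (c - ∑ o, q o * l o) 0 :=
    (hexp c).sub (HasDerivAt.fun_sum fun o _ => (hexp (l o)).const_mul (q o))
  have hslope := (hasDerivAt_iff_tendsto_slope.1 hF).eventually_const_lt (sub_pos.2 hc)
  filter_upwards [hslope.filter_mono (nhdsWithin_mono 0 fun θ hθ => ne_of_gt hθ),
    self_mem_nhdsWithin] with θ hθ (hθ₀ : 0 < θ)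
  rw [slope_def_field, hF₀, sub_zero, sub_zero] at hθ
  exact (sub_pos.1 ((div_pos_iff_of_pos_right hθ₀).1 hθ)).le

variable {ι : Type*} [Fintype ι] [DecidableEq ι] {ρ σ : Matrix ι ι ℂ}

/-- The square root of `ρ`, as a matrix from the eigenbasis of `ρ` to that of `σ`. The squared
moduli of its entries form the distribution of Nussbaum and Szkoła. -/
def sqrtOverlap (hσ : σ.IsHermitian) (hρ : ρ.IsHermitian) : Matrix ι ι ℂ :=
  (overlap hσ hρ : Matrix ι ι ℂ) * diagonal fun j => ((√(hρ.eigenvalues j) : ℝ) : ℂ)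

theorem sqrtOverlap_mul_conjTranspose (hσ : σ.IsHermitian) (hρ : ρ.PosSemidef) :
    sqrtOverlap hσ hρ.1 * (sqrtOverlap hσ hρ.1)ᴴ =
      (hσ.eigenvectorUnitary : Matrix ι ι ℂ)ᴴ * ρ * (hσ.eigenvectorUnitary : Matrix ι ι ℂ) := by
  have hspec := cfc_eq_eigenvectorUnitary_mul_diagonal hρ.1 fun x => x
  rw [cfc_id' ℝ ρ hρ.1.isSelfAdjoint] at hspec
  have hsqrt : (diagonal fun j => ((√(hρ.1.eigenvalues j) : ℝ) : ℂ)) *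
      (diagonal fun j => ((√(hρ.1.eigenvalues j) : ℝ) : ℂ))ᴴ =
      diagonal fun j => (hρ.1.eigenvalues j : ℂ) := by
    rw [diagonal_conjTranspose, diagonal_mul_diagonal]
    congr 1
    funext j
    simp [← Complex.ofReal_mul, Real.mul_self_sqrt (hρ.eigenvalues_nonneg j)]
  have hO : (overlap hσ hρ.1 : Matrix ι ι ℂ) =
      (hσ.eigenvectorUnitary : Matrix ι ι ℂ)ᴴ * (hρ.1.eigenvectorUnitary : Matrix ι ι ℂ) := rfl
  conv_rhs => rw [hspec, ← hsqrt]
  rw [sqrtOverlap, conjTranspose_mul, hO, conjTranspose_mul, conjTranspose_conjTranspose]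
  simp only [Matrix.mul_assoc]

theorem conjTranspose_mul_sqrtOverlap (hσ : σ.IsHermitian) (hρ : ρ.PosSemidef) :
    (sqrtOverlap hσ hρ.1)ᴴ * sqrtOverlap hσ hρ.1 =
      diagonal fun j => (hρ.1.eigenvalues j : ℂ) := by
  have hO : (overlap hσ hρ.1 : Matrix ι ι ℂ)ᴴ * (overlap hσ hρ.1 : Matrix ι ι ℂ) = 1 :=
    Unitary.coe_star_mul_self (overlap hσ hρ.1)
  rw [sqrtOverlap, conjTranspose_mul, Matrix.mul_assoc,
    ← Matrix.mul_assoc _ (overlap hσ hρ.1 : Matrix ι ι ℂ), hO, Matrix.one_mul,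
    diagonal_conjTranspose, diagonal_mul_diagonal]
  congr 1
  funext j
  simp [← Complex.ofReal_mul, Real.mul_self_sqrt (hρ.eigenvalues_nonneg j)]

theorem norm_sqrtOverlap_sq (hσ : σ.IsHermitian) (hρ : ρ.PosSemidef) (i j : ι) :
    ‖sqrtOverlap hσ hρ.1 i j‖ ^ 2 =
      ‖(overlap hσ hρ.1 : Matrix ι ι ℂ) i j‖ ^ 2 * hρ.1.eigenvalues j := by
  rw [sqrtOverlap, mul_diagonal, norm_mul, mul_pow, Complex.norm_real, Real.norm_eq_abs, sq_abs,
    Real.sq_sqrt (hρ.eigenvalues_nonneg j)]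

theorem sum_eigenvalues_eq_one (hρ : ρ.IsHermitian) (hρ₁ : ρ.trace = 1) :
    ∑ j, hρ.eigenvalues j = 1 := by
  rw [← re_trace_cfc hρ fun x => x, cfc_id' ℝ ρ hρ.isSelfAdjoint, hρ₁, Complex.one_re]

theorem sum_norm_sqrtOverlap_sq (hσ : σ.IsHermitian) (hρ : ρ.PosSemidef) (hρ₁ : ρ.trace = 1) :
    ∑ i, ∑ j, ‖sqrtOverlap hσ hρ.1 i j‖ ^ 2 = 1 := by
  rw [Finset.sum_comm, ← sum_eigenvalues_eq_one hρ.1 hρ₁]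
  refine Finset.sum_congr rfl fun j _ => Complex.ofReal_injective ?_
  rw [sum_norm_sq_col, conjTranspose_mul_sqrtOverlap hσ hρ, diagonal_apply_eq]

theorem eventually_likelihoodMoment_sqrtOverlap_le (hρ : ρ.PosSemidef) (hρ₁ : ρ.trace = 1)
    (hσ : σ.PosDef) {c : ℝ} (hc : relEntropy ρ σ < c) :
    ∀ᶠ θ : ℝ in 𝓝[>] 0, likelihoodMoment (sqrtOverlap hσ.1 hρ.1) hρ.1.eigenvalues
      hσ.1.eigenvalues θ ≤ Real.exp (θ * c) := by
  set q : ι × ι → ℝ := fun p => ‖sqrtOverlap hσ.1 hρ.1 p.1 p.2‖ ^ 2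
  set l : ι × ι → ℝ := fun p => Real.log (hρ.1.eigenvalues p.2) - Real.log (hσ.1.eigenvalues p.1)
  have hq : ∑ p, q p = 1 := by
    rw [Fintype.sum_prod_type]
    exact sum_norm_sqrtOverlap_sq hσ.1 hρ hρ₁
  have hmean : ∑ p, q p * l p = relEntropy ρ σ := by
    simp only [q, l, Fintype.sum_prod_type, relEntropy_eq_sum hρ.1 hσ.1,
      norm_sqrtOverlap_sq hσ.1 hρ, mul_assoc]
  filter_upwards [eventually_sum_mul_exp_le hq (hmean.trans_lt hc)] with θ hθ
  refine le_trans (le_of_eq ?_) hθ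
  rw [likelihoodMoment, Fintype.sum_prod_type]
  refine Finset.sum_congr rfl fun i _ => Finset.sum_congr rfl fun j _ => ?_
  rcases (hρ.eigenvalues_nonneg j).eq_or_lt with hr | hr
  · simp only [q, norm_sqrtOverlap_sq hσ.1 hρ, ← hr, mul_zero, zero_mul]
  · have hs := hσ.eigenvalues_pos i
    rw [Real.rpow_def_of_pos (div_pos hr hs), Real.log_div hr.ne' hs.ne', mul_comm _ θ]

end LikelihoodMoment

/-! ### Tensor products -/

section TensorProd

open Matrix

variable {ι : Type*} {n : ℕ}

theorem conjTranspose_tensorProd (A : Fin n → Matrix ι ι ℂ) :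
    (tensorProd A)ᴴ = tensorProd fun k => (A k)ᴴ := by
  ext i j
  simp [tensorProd, conjTranspose_apply]

theorem tensorProd_diagonal [DecidableEq ι] (d : Fin n → ι → ℂ) :
    tensorProd (fun k => diagonal (d k)) = diagonal fun j => ∏ k, d k (j k) := by
  ext i j
  by_cases h : i = j
  · subst h
    simp [tensorProd]
  · obtain ⟨k, hk⟩ := Function.ne_iff.1 h
    rw [diagonal_apply_ne _ h, tensorProd, of_apply]
    exact Finset.prod_eq_zero (Finset.mem_univ k) (diagonal_apply_ne _ hk)

theorem tensorProd_one [DecidableEq ι] :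
    tensorProd (fun _ : Fin n => (1 : Matrix ι ι ℂ)) = 1 := by
  simp only [← diagonal_one, tensorProd_diagonal, Finset.prod_const_one]

variable [Fintype ι]

theorem tensorProd_mul_tensorProd (A B : Fin n → Matrix ι ι ℂ) :
    tensorProd A * tensorProd B = tensorProd fun k => A k * B k := by
  ext i j
  simp only [tensorProd, Matrix.mul_apply, of_apply, ← Finset.prod_mul_distrib]
  exact (Fintype.prod_sum fun k m => A k (i k) m * B k m (j k)).symm

theorem trace_tensorProd (A : Fin n → Matrix ι ι ℂ) :
    (tensorProd A).trace = ∏ k, (A k).trace :=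
  (Fintype.prod_sum fun k i => A k i i).symm

theorem likelihoodMoment_nonneg {G : Matrix ι ι ℂ} {w s : ι → ℝ} (hw : 0 ≤ w) (hs : 0 ≤ s)
    (θ : ℝ) : 0 ≤ likelihoodMoment G w s θ :=
  Finset.sum_nonneg fun i _ => Finset.sum_nonneg fun j _ =>
    mul_nonneg (sq_nonneg _) (Real.rpow_nonneg (div_nonneg (hw j) (hs i)) θ)

theorem likelihoodMoment_tensorProd (G : Fin n → Matrix ι ι ℂ) {w s : Fin n → ι → ℝ}
    (hw : ∀ k, 0 ≤ w k) (hs : ∀ k, 0 ≤ s k) (θ : ℝ) :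
    likelihoodMoment (tensorProd G) (fun j => ∏ k, w k (j k)) (fun i => ∏ k, s k (i k)) θ =
      ∏ k, likelihoodMoment (G k) (w k) (s k) θ := by
  have hentry (i j : Fin n → ι) :
      ‖tensorProd G i j‖ ^ 2 * ((∏ k, w k (j k)) / ∏ k, s k (i k)) ^ θ =
        ∏ k, ‖G k (i k) (j k)‖ ^ 2 * (w k (j k) / s k (i k)) ^ θ := by
    rw [Finset.prod_mul_distrib, Real.finsetProd_rpow _ _
      (fun k _ => div_nonneg (hw k _) (hs k _)), Finset.prod_div_distrib, Finset.prod_pow,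
      tensorProd, of_apply, norm_prod]
  simp only [likelihoodMoment, hentry, Fintype.prod_sum]

end TensorProd

namespace CQChannel

/-! ### Covering of memoryless channels -/

section BlockCovering

open Matrix Filter Topology

variable {X ι : Type*} [Fintype X] [Fintype ι]

theorem blockOutput_eq_sum_real_smul (W : CQChannel X ι) {n : ℕ} (P : (Fin n → X) → ℝ) :
    W.blockOutput P = ∑ x, P x • W.blockState x := by
  simp only [blockOutput, Complex.coe_smul]

variable [DecidableEq ι] {S : Matrix ι ι ℂ}

theorem tensorProd_sqrtOverlap_mul_conjTranspose (W : CQChannel X ι) (hS : S.IsHermitian) {n : ℕ}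
    (x : Fin n → X) :
    (tensorProd fun k => sqrtOverlap hS (W.posSemidef (x k)).1) *
        (tensorProd fun k => sqrtOverlap hS (W.posSemidef (x k)).1)ᴴ =
      (tensorProd fun _ => (hS.eigenvectorUnitary : Matrix ι ι ℂ))ᴴ * W.blockState x *
        tensorProd fun _ => (hS.eigenvectorUnitary : Matrix ι ι ℂ) := by
  simp only [blockState, conjTranspose_tensorProd, tensorProd_mul_tensorProd,
    sqrtOverlap_mul_conjTranspose hS (W.posSemidef _)]

theorem exists_effectClose_blockOutput_of_likelihoodMoment_le (W : CQChannel X ι) (hS : S.PosDef)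
    (hS₁ : S.trace = 1) {θ L : ℝ} (hθ : 0 ≤ θ)
    (hL : ∀ x, likelihoodMoment (sqrtOverlap hS.1 (W.posSemidef x).1)
      (W.posSemidef x).1.eigenvalues hS.1.eigenvalues θ ≤ L)
    {n : ℕ} {R ε : ℝ} (hR : 0 < R) (hε : 0 ≤ ε) (hLR : L ^ n ≤ R ^ θ * ε ^ 2)
    {P : (Fin n → X) → ℝ} (hP : P ∈ stdSimplex ℝ (Fin n → X)) {M : ℕ} (hM : 0 < M) :
    ∃ f : Fin M → Fin n → X, EffectClose (ε + √R / √M + ε)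
      (∑ m, (M : ℝ)⁻¹ • W.blockState (f m)) (W.blockOutput P) := by
  have hw (x : X) : 0 ≤ (W.posSemidef x).1.eigenvalues := (W.posSemidef x).eigenvalues_nonneg
  have hs : 0 ≤ hS.1.eigenvalues := fun i => (hS.eigenvalues_pos i).le
  obtain ⟨f, hf⟩ := exists_effectClose_average_of_likelihoodMoment_le
    (G := fun x : Fin n → X => tensorProd fun k => sqrtOverlap hS.1 (W.posSemidef (x k)).1)
    (w := fun x j => ∏ k, (W.posSemidef (x k)).1.eigenvalues (j k))
    (s := fun i => ∏ k, hS.1.eigenvalues (i k)) (θ := θ)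
    (fun i => Finset.prod_pos fun k _ => hS.eigenvalues_pos (i k))
    (by simp [← Fintype.prod_sum, sum_eigenvalues_eq_one hS.1 hS₁])
    (fun x j => Finset.prod_nonneg fun k _ => hw (x k) (j k))
    (fun x => by simp [← Fintype.prod_sum, sum_eigenvalues_eq_one _ (W.trace_eq_one _)])
    (fun x => by
      simp only [conjTranspose_tensorProd, tensorProd_mul_tensorProd, tensorProd_diagonal,
        conjTranspose_mul_sqrtOverlap hS.1 (W.posSemidef _), Complex.ofReal_prod])
    hR hθ hε
    (fun x => by
      rw [likelihoodMoment_tensorProd _ (fun k => hw (x k)) (fun _ => hs)]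
      calc _ ≤ ∏ _k : Fin n, L := Finset.prod_le_prod
            (fun k _ => likelihoodMoment_nonneg (hw (x k)) hs θ) fun k _ => hL (x k)
        _ = L ^ n := by simp
        _ ≤ R ^ θ * ε ^ 2 := hLR) hP hM
  refine ⟨f, EffectClose.of_conj
    (V := tensorProd fun _ => (hS.1.eigenvectorUnitary : Matrix ι ι ℂ)) ?_ ?_⟩
  · have hU : (hS.1.eigenvectorUnitary : Matrix ι ι ℂ)ᴴ *
        (hS.1.eigenvectorUnitary : Matrix ι ι ℂ) = 1 :=
      Unitary.coe_star_mul_self hS.1.eigenvectorUnitary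
    rw [conjTranspose_tensorProd, tensorProd_mul_tensorProd]
    simp only [hU, tensorProd_one]
  · simpa only [tensorProd_sqrtOverlap_mul_conjTranspose, blockOutput_eq_sum_real_smul,
      Matrix.mul_sum, Matrix.sum_mul, Matrix.mul_smul, Matrix.smul_mul] using hf

theorem exists_likelihoodMoment_sqrtOverlap_le [Nonempty X] (W : CQChannel X ι) {c : ℝ}
    (hc : W.capacity (Real.exp 1) < c) :
    ∃ (S : Matrix ι ι ℂ) (hS : S.PosDef) (θ : ℝ), S.trace = 1 ∧ θ ∈ Set.Ioc 0 1 ∧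
      ∀ x, likelihoodMoment (sqrtOverlap hS.1 (W.posSemidef x).1)
        (W.posSemidef x).1.eigenvalues hS.1.eigenvalues θ ≤ Real.exp (θ * c) := by
  obtain ⟨S, hS, hS₁, hdiv⟩ := W.exists_posDef_relEntropy_lt hc
  have hmoment := eventually_all.2 fun x =>
    eventually_likelihoodMoment_sqrtOverlap_le (W.posSemidef x) (W.trace_eq_one x) hS (hdiv x)
  obtain ⟨θ, hθ, hθ₀₁⟩ := (hmoment.and (Ioc_mem_nhdsGT one_pos)).exists
  exact ⟨S, hS, θ, hS₁, hθ₀₁, hθ⟩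

/-- The truncation level is `R = exp (n r)` with `r` halfway between `c` and a bound `c'` for the
relative entropies: for `r < c` sampling succeeds, and for `c' < r` the truncation is harmless. -/
theorem exists_effectClose_blockOutput [Nonempty X] (W : CQChannel X ι) {c : ℝ}
    (hc : W.capacity (Real.exp 1) < c) :
    ∃ κ : ℝ, 0 < κ ∧ ∀ n M : ℕ, Real.exp (n * c) ≤ M → ∀ P ∈ stdSimplex ℝ (Fin n → X),
      ∃ f : Fin M → Fin n → X, EffectClose (3 * Real.exp (-(n * κ)))
        (∑ m, (M : ℝ)⁻¹ • W.blockState (f m)) (W.blockOutput P) := by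
  obtain ⟨c', hc', hc'c⟩ := exists_between hc
  obtain ⟨γ, hγ, rfl⟩ : ∃ γ : ℝ, 0 < γ ∧ c' + 2 * γ = c :=
    ⟨(c - c') / 2, by linarith, by ring⟩
  obtain ⟨S, hS, θ, hS₁, ⟨hθ₀, hθ₁⟩, hmoment⟩ := W.exists_likelihoodMoment_sqrtOverlap_le hc'
  refine ⟨θ * γ / 2, by positivity, fun n M hM P hP => ?_⟩
  have hM₀ : (0 : ℝ) < M := (Real.exp_pos _).trans_le hM
  set ε := Real.exp (-(n * (θ * γ / 2)))
  obtain ⟨f, hf⟩ := W.exists_effectClose_blockOutput_of_likelihoodMoment_le hS hS₁ hθ₀.le hmoment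
    (R := Real.exp (n * (c' + γ))) (ε := ε) (Real.exp_pos _) (Real.exp_pos _).le (le_of_eq (by
      rw [← Real.exp_mul, ← Real.exp_nat_mul, ← Real.exp_nat_mul, ← Real.exp_add]
      push_cast
      ring_nf)) hP (Nat.cast_pos.1 hM₀)
  have hsample : √(Real.exp (n * (c' + γ))) / √M ≤ ε := by
    rw [← Real.sqrt_div (Real.exp_pos _).le, Real.sqrt_le_left (Real.exp_pos _).le,
      div_le_iff₀ hM₀]
    calc Real.exp (n * (c' + γ)) = Real.exp (-(n * γ)) * Real.exp (n * (c' + 2 * γ)) := by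
          rw [← Real.exp_add]
          ring_nf
      _ ≤ ε ^ 2 * M := by
          refine mul_le_mul ?_ hM (Real.exp_pos _).le (sq_nonneg _)
          rw [← Real.exp_nat_mul, Real.exp_le_exp]
          have hθγ : n * (θ * γ) ≤ n * γ := by
            gcongr
            exact mul_le_of_le_one_left hγ.le hθ₁
          push_cast
          linarith
  exact ⟨f, fun D hD hD₁ => (hf D hD hD₁).trans (by linarith)⟩

end BlockCovering

end CQChannel

/-! ### The strong converse -/

section Counting

open Filter

theorem eventually_pow_pow_ceil_exp_le (m : ℕ) {a c c' : ℝ} (ha : 0 < a) (hc : 0 ≤ c)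
    (hcc' : c < c') :
    ∀ᶠ n : ℕ in atTop,
      ((m : ℝ) ^ n) ^ ⌈Real.exp (n * c)⌉₊ ≤ Real.exp (a * Real.exp (n * c')) := by
  have hlinear : (fun x : ℝ => 2 * m * x ^ 1) =o[atTop] fun x => Real.exp ((c' - c) * x) :=
    (isLittleO_pow_exp_pos_mul_atTop 1 (sub_pos.2 hcc')).const_mul_left _
  filter_upwards [tendsto_natCast_atTop_atTop.eventually (hlinear.bound ha)] with n hn
  have hn' : 2 * m * n ≤ a * Real.exp ((c' - c) * n) := by
    simpa [abs_of_nonneg] using hn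
  have hceil : (⌈Real.exp (n * c)⌉₊ : ℝ) ≤ 2 * Real.exp (n * c) := by
    linarith [Nat.ceil_lt_add_one (Real.exp_pos (n * c)).le,
      Real.one_le_exp (show 0 ≤ n * c by positivity)]
  calc ((m : ℝ) ^ n) ^ ⌈Real.exp (n * c)⌉₊ ≤ (Real.exp m ^ n) ^ ⌈Real.exp (n * c)⌉₊ := by
        gcongr
        linarith [Real.add_one_le_exp (m : ℝ)]
    _ = Real.exp (m * n * ⌈Real.exp (n * c)⌉₊) := by
        rw [← Real.exp_nat_mul, ← Real.exp_nat_mul]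
        ring_nf
    _ ≤ Real.exp (m * n * (2 * Real.exp (n * c))) := by gcongr
    _ = Real.exp (2 * m * n * Real.exp (n * c)) := by ring_nf
    _ ≤ Real.exp (a * Real.exp ((c' - c) * n) * Real.exp (n * c)) := by gcongr
    _ = Real.exp (a * Real.exp (n * c')) := by
        rw [mul_assoc, ← Real.exp_add]
        ring_nf

theorem bddAbove_and_sSup_le {s : Set ℕ} {B : ℝ} (hB : 0 ≤ B) (h : ∀ N ∈ s, (N : ℝ) ≤ B) :
    BddAbove s ∧ ((sSup s : ℕ) : ℝ) ≤ B := by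
  have hbdd : BddAbove s := ⟨⌊B⌋₊, fun N hN => Nat.le_floor (h N hN)⟩
  refine ⟨hbdd, ?_⟩
  rcases s.eq_empty_or_nonempty with rfl | hne
  · simpa using hB
  · exact h _ (Nat.sSup_mem hne hbdd)

end Counting

namespace CQChannel

section Converse

open Matrix Filter Topology

variable {X ι : Type*} [Fintype X] [Fintype ι]

theorem trace_blockOutput (W : CQChannel X ι) {n : ℕ} {P : (Fin n → X) → ℝ}
    (hP : P ∈ stdSimplex ℝ (Fin n → X)) : (W.blockOutput P).trace = 1 := by
  simp only [blockOutput, blockState, trace_sum, trace_smul, trace_tensorProd, W.trace_eq_one,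
    Finset.prod_const_one, smul_eq_mul, mul_one, ← Complex.ofReal_sum, hP.2, Complex.ofReal_one]

variable [DecidableEq ι] {l₁ l₂ : ℝ}

theorem IsQIDCode.injective_of_effectClose {W : CQChannel X ι} {n N : ℕ}
    {P : Fin N → (Fin n → X) → ℝ} {D : Fin N → Matrix (Fin n → ι) (Fin n → ι) ℂ}
    (hcode : W.IsQIDCode n N l₁ l₂ P D) {F : Type*} {f : Fin N → F}
    {σ : F → Matrix (Fin n → ι) (Fin n → ι) ℂ} {η : ℝ}
    (hσ : ∀ i, EffectClose η (σ (f i)) (W.blockOutput (P i))) (hη : l₁ + l₂ + 2 * η < 1) :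
    Function.Injective f := by
  intro i j hij
  by_contra hne
  have hclose : EffectClose (η + η) (W.blockOutput (P i)) (W.blockOutput (P j)) :=
    (hσ i).symm.trans (hij ▸ hσ j)
  have hdiff := (abs_le.1 (hclose (D i) (hcode.nonneg i) (hcode.le_one i))).2
  have hfirst := hcode.first_kind i
  have hsecond := hcode.second_kind i j hne
  rw [Matrix.sub_mul, trace_sub, Complex.sub_re] at hdiff
  rw [Matrix.mul_sub, Matrix.mul_one, trace_sub, trace_blockOutput W (hcode.prob i),
    Complex.sub_re, Complex.one_re] at hfirst
  linarith

theorem le_pow_of_mem_qidSizes {W : CQChannel X ι} {n M N : ℕ} {η : ℝ}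
    (hcover : ∀ P ∈ stdSimplex ℝ (Fin n → X), ∃ f : Fin M → Fin n → X,
      EffectClose η (∑ m, (M : ℝ)⁻¹ • W.blockState (f m)) (W.blockOutput P))
    (hη : l₁ + l₂ + 2 * η < 1) (hN : N ∈ W.qidSizes n l₁ l₂) :
    N ≤ (Fintype.card X ^ n) ^ M := by
  classical
  obtain ⟨P, D, hcode⟩ := hN
  choose f hf using fun i => hcover (P i) (hcode.prob i)
  have hinj : Function.Injective f := hcode.injective_of_effectClose
    (σ := fun f => ∑ m, (M : ℝ)⁻¹ • W.blockState (f m)) hf hη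
  simpa using Fintype.card_le_of_injective f hinj

theorem eq_zero_of_mem_qidSizes [IsEmpty X] {W : CQChannel X ι} {n N : ℕ} (hn : n ≠ 0)
    (hN : N ∈ W.qidSizes n l₁ l₂) : N = 0 := by
  obtain ⟨P, D, hcode⟩ := hN
  have : NeZero n := ⟨hn⟩
  by_contra hN₀
  simpa using (hcode.prob ⟨0, Nat.pos_of_ne_zero hN₀⟩).2

theorem eventually_qidSizes_le_exp [Nonempty X] (W : CQChannel X ι) (hl : l₁ + l₂ < 1)
    {a c : ℝ} (ha : 0 < a) (hc : W.capacity (Real.exp 1) < c) :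
    ∀ᶠ n : ℕ in atTop, ∀ N ∈ W.qidSizes n l₁ l₂, (N : ℝ) ≤ Real.exp (a * Real.exp (n * c)) := by
  obtain ⟨c', hc', hc'c⟩ := exists_between hc
  obtain ⟨κ, hκ, hcover⟩ := W.exists_effectClose_blockOutput hc'
  have herror : Tendsto (fun n : ℕ => l₁ + l₂ + 2 * (3 * Real.exp (-(n * κ)))) atTop
      (𝓝 (l₁ + l₂)) := by
    have hexp : Tendsto (fun n : ℕ => Real.exp (-(n * κ))) atTop (𝓝 0) :=
      Real.tendsto_exp_neg_atTop_nhds_zero.comp (tendsto_natCast_atTop_atTop.atTop_mul_const hκ)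
    simpa using ((hexp.const_mul 3).const_mul 2).const_add (l₁ + l₂)
  filter_upwards [herror.eventually_lt_const hl,
    eventually_pow_pow_ceil_exp_le (Fintype.card X) ha (W.capacity_nonneg.trans hc'.le) hc'c]
    with n hn hcount N hN
  refine le_trans ?_ hcount
  exact_mod_cast le_pow_of_mem_qidSizes (hcover n _ (Nat.le_ceil _)) hn hN

theorem rpow_rpow_capacity_add {b : ℝ} (hb : 1 < b) (W : CQChannel X ι) (t δ : ℝ) :
    b ^ (b ^ (t * (W.capacity b + δ))) =
      Real.exp (Real.log b *
        Real.exp (t * (W.capacity (Real.exp 1) + Real.log b * δ))) := by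
  have hb₀ : 0 < b := zero_lt_one.trans hb
  rw [Real.rpow_def_of_pos hb₀, Real.rpow_def_of_pos hb₀, W.capacity_eq_div_log hb.le]
  have := (Real.log_pos hb).ne'
  congr 3
  field_simp

theorem eventually_qidSizes_le (W : CQChannel X ι) {b δ : ℝ} (hb : 1 < b) (hl : l₁ + l₂ < 1)
    (hδ : 0 < δ) :
    ∀ᶠ n : ℕ in atTop, ∀ N ∈ W.qidSizes n l₁ l₂,
      (N : ℝ) ≤ b ^ (b ^ ((n : ℝ) * (W.capacity b + δ))) := by
  have hlog : 0 < Real.log b := Real.log_pos hb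
  simp only [W.rpow_rpow_capacity_add hb]
  rcases isEmpty_or_nonempty X with hX | hX
  · filter_upwards [eventually_ne_atTop 0] with n hn N hN
    rw [eq_zero_of_mem_qidSizes hn hN, Nat.cast_zero]
    exact (Real.exp_pos _).le
  · exact W.eventually_qidSizes_le_exp hl hlog (lt_add_of_pos_right _ (mul_pos hlog hδ))

end Converse

end CQChannel

/-! ### Classical channels as diagonal classical–quantum channels -/

section Diagonal

open Matrix

variable {J : Type*} [DecidableEq J]

theorem posSemidef_diagonal_ofReal {p : J → ℝ} (hp : 0 ≤ p) :
    (diagonal fun y => (p y : ℂ)).PosSemidef :=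
  PosSemidef.diagonal fun y => Complex.zero_le_real.2 (hp y)

/-- The orthogonal projection on the span of the basis vectors in `S`, the effect of the classical
event `S`. -/
def diagonalProj (S : Finset J) : Matrix J J ℂ :=
  diagonal fun y => ((if y ∈ S then 1 else 0 : ℝ) : ℂ)

theorem posSemidef_diagonalProj (S : Finset J) : (diagonalProj S).PosSemidef :=
  posSemidef_diagonal_ofReal fun y => by
    rw [Pi.zero_apply]
    split_ifs <;> norm_num

variable [Fintype J]

theorem one_sub_diagonalProj (S : Finset J) : 1 - diagonalProj S = diagonalProj Sᶜ := by
  rw [diagonalProj, diagonalProj, ← diagonal_one, diagonal_sub]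
  congr 1
  funext y
  by_cases h : y ∈ S <;> simp [h]

theorem map_eigenvalues_diagonal_ofReal {p : J → ℝ}
    (h : (diagonal fun y => (p y : ℂ)).IsHermitian) :
    Finset.univ.val.map h.eigenvalues = Finset.univ.val.map p := by
  have hroots : (diagonal fun y => (p y : ℂ)).charpoly.roots =
      Finset.univ.val.map fun y => (p y : ℂ) := by
    have hprod : ∏ y, (Polynomial.X - Polynomial.C (p y : ℂ)) =
        ((Finset.univ.val.map fun y => (p y : ℂ)).map
          fun a => Polynomial.X - Polynomial.C a).prod := by
      rw [Multiset.map_map]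
      rfl
    rw [charpoly_diagonal, hprod, Polynomial.roots_multiset_prod_X_sub_C]
  rw [h.roots_charpoly_eq_eigenvalues] at hroots
  refine Multiset.map_injective Complex.ofReal_injective ?_
  rw [Multiset.map_map, Multiset.map_map]
  exact hroots

theorem vonNeumannEntropy_diagonal_ofReal (b : ℝ) (p : J → ℝ) :
    vonNeumannEntropy b (diagonal fun y => (p y : ℂ)) = shannonEntropy b p := by
  have h : (diagonal fun y => (p y : ℂ)).IsHermitian :=
    isHermitian_diagonal_of_self_adjoint _ (by ext y; simp)
  have hsum := congrArg (fun m => (m.map fun t => t * Real.logb b t).sum)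
    (map_eigenvalues_diagonal_ofReal h)
  simp only [Multiset.map_map] at hsum
  rw [vonNeumannEntropy, mul_cfc_eq_cfc h, re_trace_cfc h, shannonEntropy]
  exact congrArg Neg.neg hsum

end Diagonal

namespace ClassicalChannel

open Matrix

variable {X Y : Type*} [Fintype X] [Fintype Y] [DecidableEq Y]

/-- The classical–quantum channel with diagonal output states given by `V`. Quantum identification
codes for it with diagonal projections are the identification codes for `V`. -/
def toCQChannel (V : ClassicalChannel X Y) : CQChannel X Y where
  state x := diagonal fun y => (V.prob x y : ℂ)
  posSemidef x := posSemidef_diagonal_ofReal (V.prob_mem x).1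
  trace_eq_one x := by
    rw [trace_diagonal, ← Complex.ofReal_sum, (V.prob_mem x).2, Complex.ofReal_one]

theorem output_toCQChannel (V : ClassicalChannel X Y) (P : X → ℝ) :
    V.toCQChannel.output P = diagonal fun y => (V.output P y : ℂ) := by
  ext i j
  rcases eq_or_ne i j with rfl | h
  · simp [CQChannel.output, toCQChannel, output, Matrix.sum_apply]
  · simp [CQChannel.output, toCQChannel, Matrix.sum_apply, h]

theorem mutualInfo_toCQChannel (b : ℝ) (V : ClassicalChannel X Y) :
    V.toCQChannel.mutualInfo b = V.mutualInfo b := by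
  funext P
  have hstate (x : X) : V.toCQChannel.state x = diagonal fun y => (V.prob x y : ℂ) := rfl
  simp only [CQChannel.mutualInfo, mutualInfo, output_toCQChannel, hstate,
    vonNeumannEntropy_diagonal_ofReal]

theorem capacity_toCQChannel (b : ℝ) (V : ClassicalChannel X Y) :
    V.toCQChannel.capacity b = V.capacity b := by
  rw [CQChannel.capacity, mutualInfo_toCQChannel, capacity]

theorem re_trace_blockOutput_mul_diagonalProj (V : ClassicalChannel X Y) {n : ℕ}
    (P : (Fin n → X) → ℝ) (S : Finset (Fin n → Y)) :
    (V.toCQChannel.blockOutput P * diagonalProj S).trace.re = V.blockProb P S := by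
  simp only [CQChannel.blockOutput, CQChannel.blockState, toCQChannel, tensorProd_diagonal,
    Matrix.sum_mul, Matrix.smul_mul, trace_sum, trace_smul, Complex.re_sum, smul_eq_mul,
    Complex.re_ofReal_mul, diagonalProj, diagonal_mul_diagonal, trace_diagonal,
    ← Complex.ofReal_prod, ← Complex.ofReal_mul, Complex.ofReal_re, blockProb, mul_ite, mul_one,
    mul_zero, Finset.sum_ite_mem, Finset.univ_inter]

theorem idSizes_subset_qidSizes (V : ClassicalChannel X Y) (n : ℕ) (l₁ l₂ : ℝ) :
    V.idSizes n l₁ l₂ ⊆ V.toCQChannel.qidSizes n l₁ l₂ := by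
  rintro N ⟨P, D, hcode⟩
  refine ⟨P, fun i => diagonalProj (D i), hcode.prob, fun i => posSemidef_diagonalProj _,
    fun i => ?_, fun i => ?_, fun i j hij => ?_⟩
  · rw [one_sub_diagonalProj]
    exact posSemidef_diagonalProj _
  · rw [one_sub_diagonalProj, re_trace_blockOutput_mul_diagonalProj]
    exact hcode.first_kind i
  · rw [re_trace_blockOutput_mul_diagonalProj]
    exact hcode.second_kind i j hij

end ClassicalChannel

end QID

end

theorem mainTheorem1 {X ι Y : Type*} [Fintype X] [Fintype ι] [DecidableEq ι]
    [Fintype Y] [DecidableEq Y]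
    (b : ℝ) (hb : 1 < b)
    (l₁ l₂ : ℝ) (hl₁ : 0 < l₁) (hl₂ : 0 < l₂) (hl : l₁ + l₂ < 1) :
    (∀ W : QID.CQChannel X ι, ∀ δ : ℝ, 0 < δ → ∃ n₀ : ℕ, ∀ n : ℕ, n₀ ≤ n →
      BddAbove (W.qidSizes n l₁ l₂) ∧
      (W.maxQIDSize n l₁ l₂ : ℝ) ≤ b ^ (b ^ ((n : ℝ) * (W.capacity b + δ)))) ∧
    (∀ V : QID.ClassicalChannel X Y, ∀ δ : ℝ, 0 < δ → ∃ n₀ : ℕ, ∀ n : ℕ, n₀ ≤ n →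
      BddAbove (V.idSizes n l₁ l₂) ∧
      (V.maxIDSize n l₁ l₂ : ℝ) ≤ b ^ (b ^ ((n : ℝ) * (V.capacity b + δ)))) := by
  have hpos : ∀ t : ℝ, 0 ≤ b ^ t := fun t => Real.rpow_nonneg (by linarith) t
  refine ⟨fun W δ hδ => ?_, fun V δ hδ => ?_⟩
  · obtain ⟨n₀, h⟩ := Filter.eventually_atTop.1 (W.eventually_qidSizes_le hb hl hδ)
    exact ⟨n₀, fun n hn => QID.bddAbove_and_sSup_le (hpos _) (h n hn)⟩
  · obtain ⟨n₀, h⟩ :=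
      Filter.eventually_atTop.1 (V.toCQChannel.eventually_qidSizes_le hb hl hδ)
    refine ⟨n₀, fun n hn => QID.bddAbove_and_sSup_le (hpos _) fun N hN => ?_⟩
    rw [← V.capacity_toCQChannel b]
    exact h n hn N (V.idSizes_subset_qidSizes n l₁ l₂ hN)
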